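/- Everything is $C^\infty$. Let $M$ be an $n$-dimensional manifold with a presymplectic form $\sigma$, i.e., a smooth closed $2$-form (of arbitrary, possibly non-constant rank), let $D_\sigma=\{(X,i(X)\sigma)\mid X\in TM\}\subseteq TM\oplus T^*M$, and let $N\subseteq M$ be an embedded submanifold of dimension $k$. A normal bundle of $N$ is a smooth subbundle $\nu N$ of $T_NM=TM|_N$ with $T_NM=\nu N\oplus TN$; it gives projections $pr_{TN}$ and $pr_{T^*N}$ (with $T^*N$ identified with the annihilator of $\nu N$). Definitions. $(N,\nu N)$ is *properly normalized* if, along $N$, $(X,\alpha)\in D_\sigma$ implies $(pr_{TN}X,pr_{T^*N}\alpha)\in D_\sigma$. Its *second fundamental form* is given, for $(X,\alpha),(Y,\beta)\in D_\sigma|_N\cap(TN\oplus T^*N)$ and $Z\in\nu N$, by $$B((X,\alpha),(Y,\beta))(Z)=Z(\tilde\alpha(\tilde Y))-\alpha([\tilde Z,\tilde Y])+\beta([\tilde Z,\tilde X]),$$ where $\tilde Z$ is a vector field on $M$ extending a section of $\nu N$ through $Z$, and $(\tilde X,\tilde\alpha),(\tilde Y,\tilde\beta)$ are sections of $D_\sigma$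 on $M$ extending sections of $D_\sigma|_N\cap(TN\oplus T^*N)$ through $(X,\alpha),(Y,\beta)$. $N$ is *totally Dirac with respect to* $\nu N$ if $(N,\nu N)$ is properly normalized and $B=0$; $N$ is *totally Dirac* if this holds for some normal bundle $\nu N$. The complete lift $\sigma^C$ is the $2$-form on $TM$ given in the natural coordinates $(x^i,v^i)$ induced by a chart of $M$ by $$\sigma^C_{(x,v)}\big((\xi,\eta),(\xi',\eta')\big)=v^k\frac{\partial\sigma_{ij}}{\partial x^k}\xi^i\xi'^j+\sigma_{ij}\eta^i\xi'^j+\sigma_{ij}\xi^i\eta'^j .$$ The total space of $\nu N$, a submanifold of $TM$, is *isotropic* in $(TM,\sigma^C)$ if $\sigma^C$ vanishes on its tangent spaces. A chart $(x^u,y^a)$ of $M$ ($u=1,\dots,k$; $a=k+1,\dots,n$) is *adapted* to $(N,\nu N)$ if in its domain $N$ has the equations $y^a=0$ and $\nu N=\mathrm{span}\{\partial/\partial y^a\}$ along $N$; in it put $\sigma_{us}=\sigma(\partial/\partial x^u,\partial/\partial x^s)$ and $\varphi_{ua}=\sigma(\partial/\partial x^u,\partial/\partial y^a)$. Proposition.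 $N$ is totally Dirac in $(M,D_\sigma)$ if and only if it has a normal bundle $\nu N$ that is an isotropic submanifold of $(TM,\sigma^C)$. Moreover, for every normal bundle $\nu N$ of $N$ the following are equivalent: 1. $N$ is totally Dirac with respect to $\nu N$; 2. $\nu N$ is isotropic in $(TM,\sigma^C)$; 3. in every adapted chart, $\varphi_{ua}=0$ and $\partial\sigma_{us}/\partial y^a=0$ along $N$ for all $u,s,a$; 4. around every point of $N$ there is an adapted chart in which $\varphi_{ua}=0$ and $\partial\sigma_{us}/\partial y^a=0$ along $N$ for all $u,s,a$. -/

import Mathlib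

open scoped Manifold ContDiff Topology
open Set Filter

noncomputable section

namespace DiracGeom

/-- The model space `ℝⁿ`. -/
abbrev Rn (n : ℕ) : Type := EuclideanSpace ℝ (Fin n)

section General

variable {E : Type*} [NormedAddCommGroup E] [NormedSpace ℝ E]
  {H : Type*} [TopologicalSpace H] (I : ModelWithCorners ℝ E H)
  (X : Type*) [TopologicalSpace X] [ChartedSpace H X]

/-- Differential `2`-forms (not necessarily smooth) on a manifold `X`. -/
abbrev TwoForm : Type _ := (x : X) → TangentSpace I x [⋀^Fin 2]→L[ℝ] ℝ

/-- A family of linear subspaces of the fibres of `TX ⊕ T*X`. -/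
abbrev PairFamily : Type _ :=
  (x : X) → Submodule ℝ (TangentSpace I x × (TangentSpace I x →L[ℝ] ℝ))

variable {I X}

/-- The Dirac structure `D_σ = {(A, i(A)σ)}` of a `2`-form `σ`
(it is a Dirac structure when `σ` is smooth and closed). -/
def graphOf (σ : TwoForm I X) : PairFamily I X := fun x =>
  { carrier := {p | ∀ B : TangentSpace I x, p.2 B = σ x ![p.1, B]}
    add_mem' := by
      intro a b ha hb B
      have h := (σ x).map_vecCons_add ![B] a.1 b.1
      have ha' := ha B
      have hb' := hb B
      simp only [Prod.fst_add, Prod.snd_add, _root_.add_apply]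
      rw [ha', hb']
      exact h.symm
    zero_mem' := by
      intro B
      have h := (σ x).map_coord_zero (m := ![0, B]) 0 rfl
      simpa using h.symm
    smul_mem' := by
      intro c a ha B
      have h := (σ x).map_vecCons_smul ![B] c a.1
      have ha' := ha B
      simp only [Prod.smul_fst, Prod.smul_snd, _root_.smul_apply]
      rw [ha']
      exact h.symm }

variable (I)

/-- The tangent space at `p` of a subset `S` of the manifold `X`: the span of the velocities at `p`
of the smooth curves through `p` that lie in `S`. When `S` is an embedded submanifold, this is its
usual tangent space, seen in `T_p X`. -/
def subsetTangent (S : Set X) (p : X) : Submodule ℝ (TangentSpace I p) :=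
  Submodule.span ℝ {v | ∃ γ : ℝ → X, ContMDiffAt 𝓘(ℝ, ℝ) I ∞ γ 0 ∧ (∀ᶠ t in 𝓝 (0 : ℝ), γ t ∈ S) ∧
    tangentMap 𝓘(ℝ, ℝ) I γ ⟨0, (1 : ℝ)⟩ = (⟨p, v⟩ : TangentBundle I X)}

/-- `S` is an isotropic submanifold of `(X, D)`: the conditions `A ∈ TS` and `(A, α) ∈ D` imply
`α ∈ ann TS`. -/
def IsIsotropic (S : Set X) (D : PairFamily I X) : Prop :=
  ∀ p ∈ S, ∀ A ∈ subsetTangent I S p, ∀ α : TangentSpace I p →L[ℝ] ℝ, (A, α) ∈ D p →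
    ∀ B ∈ subsetTangent I S p, α B = 0

end General

section Forms

variable {n : ℕ} {M : Type*} [TopologicalSpace M] [ChartedSpace (Rn n) M] [IsManifold (𝓡 n) ∞ M]

/-- The expression of a `2`-form in a chart `φ` of `M`, a `2`-form on `φ.target ⊆ ℝⁿ`: the pullback
by `φ⁻¹`. -/
def TwoForm.inChart (σ : TwoForm (𝓡 n) M) (φ : OpenPartialHomeomorph M (Rn n)) (y : Rn n) :
    Rn n [⋀^Fin 2]→L[ℝ] ℝ :=
  (σ (φ.symm y)).compContinuousLinearMap (mfderiv 𝓘(ℝ, Rn n) (𝓡 n) φ.symm y)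

/-- The component `σ(∂ᵢ, ∂ⱼ)` of a `2`-form in a chart, as a function on `φ.target ⊆ ℝⁿ`. -/
def TwoForm.component (σ : TwoForm (𝓡 n) M) (φ : OpenPartialHomeomorph M (Rn n)) (i j : Fin n)
    (y : Rn n) : ℝ :=
  σ.inChart φ y ![EuclideanSpace.single i 1, EuclideanSpace.single j 1]

/-- `σ` is a presymplectic form on `M`: a smooth closed `2`-form. -/
structure IsPresymplectic (σ : TwoForm (𝓡 n) M) : Prop where
  smooth : ∀ φ ∈ IsManifold.maximalAtlas (𝓡 n) ∞ M, ContDiffOn ℝ ∞ (σ.inChart φ) φ.target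
  closed : ∀ φ ∈ IsManifold.maximalAtlas (𝓡 n) ∞ M, ∀ y ∈ φ.target, extDeriv (σ.inChart φ) y = 0

/-- The natural coordinates `(xⁱ, vⁱ)` on `TM` induced by a chart of `M`. -/
def natCoord (φ : OpenPartialHomeomorph M (Rn n)) (p : TangentBundle (𝓡 n) M) : Rn n × Rn n :=
  (φ p.1, mfderiv (𝓡 n) 𝓘(ℝ, Rn n) φ p.1 p.2)

/-- The complete lift of a `2`-form `s` on an open subset of `ℝⁿ`, in the coordinates `(x, v)`;
its value on two vectors is given by `coordCompleteLift_apply`. -/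
def coordCompleteLift (s : Rn n → Rn n [⋀^Fin 2]→L[ℝ] ℝ) (z : Rn n × Rn n) :
    (Rn n × Rn n) [⋀^Fin 2]→L[ℝ] ℝ :=
  (fderiv ℝ s z.1 z.2).compContinuousLinearMap (ContinuousLinearMap.fst ℝ (Rn n) (Rn n))
  + (s z.1).compContinuousLinearMap
      (ContinuousLinearMap.fst ℝ (Rn n) (Rn n) + ContinuousLinearMap.snd ℝ (Rn n) (Rn n))
  - (s z.1).compContinuousLinearMap (ContinuousLinearMap.fst ℝ (Rn n) (Rn n))
  - (s z.1).compContinuousLinearMap (ContinuousLinearMap.snd ℝ (Rn n) (Rn n))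

/-- On the vectors `ξⁱ∂/∂xⁱ + ηⁱ∂/∂vⁱ` and `ξ'ⁱ∂/∂xⁱ + η'ⁱ∂/∂vⁱ` at `(x, v)`, the complete lift of
`s` takes the value `vᵏ(∂ₖ s)(ξ, ξ') + s(η, ξ') + s(ξ, η')`. -/
theorem coordCompleteLift_apply (s : Rn n → Rn n [⋀^Fin 2]→L[ℝ] ℝ) (x v ξ η ξ' η' : Rn n) :
    coordCompleteLift s (x, v) ![(ξ, η), (ξ', η')] =
      fderiv ℝ s x v ![ξ, ξ'] + s x ![η, ξ'] + s x ![ξ, η'] := by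
  have e : ∀ (f : Rn n × Rn n →L[ℝ] Rn n) (a b : Rn n × Rn n), (f ∘ ![a, b]) = ![f a, f b] := by
    intro f a b; ext i; fin_cases i <;> rfl
  have h1 : ∀ a b c : Rn n, s x ![a + b, c] = s x ![a, c] + s x ![b, c] := fun a b c =>
    (s x).map_vecCons_add ![c] a b
  have h2 : ∀ a b c : Rn n, s x ![a, b + c] = s x ![a, b] + s x ![a, c] := by
    intro a b c
    have sw : ∀ p q : Rn n, s x ![p, q] = - s x ![q, p] := by
      intro p q
      have h := (s x).toAlternatingMap.map_swap ![q, p] (i := 0) (j := 1) (by decide)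
      have e2 : (![q, p] ∘ Equiv.swap (0 : Fin 2) 1) = ![p, q] := by
        ext i; fin_cases i <;> rfl
      rw [e2] at h
      exact h
    rw [sw a, sw a b, sw a c, h1]; ring
  simp only [coordCompleteLift, ContinuousAlternatingMap.add_apply,
    ContinuousAlternatingMap.sub_apply, ContinuousAlternatingMap.compContinuousLinearMap_apply, e]
  simp only [_root_.add_apply, ContinuousLinearMap.coe_fst', ContinuousLinearMap.coe_snd', h1, h2]
  ring

/-- The complete lift `σ^C` of a `2`-form `σ` on `M`, a `2`-form on the manifold `TM`: at `p ∈ TM`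
it is given by the local expression in the natural coordinates of `TM` induced by a chart of `M`
around the base point of `p` (the result does not depend on that chart). -/
def TwoForm.completeLift (σ : TwoForm (𝓡 n) M) : TwoForm (𝓡 n).tangent (TangentBundle (𝓡 n) M) :=
  fun p =>
    (coordCompleteLift (σ.inChart (chartAt (Rn n) p.1))
      (natCoord (chartAt (Rn n) p.1) p)).compContinuousLinearMap
      (mfderiv (𝓡 n).tangent 𝓘(ℝ, Rn n × Rn n) (natCoord (chartAt (Rn n) p.1)) p)

/-- The derivative `v(f)` of a function `f` along the tangent vector `v` at `x`. -/
def derivAlong (f : M → ℝ) (x : M) (v : TangentSpace (𝓡 n) x) : ℝ :=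
  mfderiv (𝓡 n) 𝓘(ℝ, ℝ) f x v

/-- `A` is a smooth vector field on the open set `U`. -/
def SmoothFieldOn (A : (x : M) → TangentSpace (𝓡 n) x) (U : Set M) : Prop :=
  ContMDiffOn (𝓡 n) (𝓡 n).tangent ∞ (fun x => (⟨x, A x⟩ : TangentBundle (𝓡 n) M)) U

/-- The expression of a `1`-form in a chart `φ` of `M`: the pullback by `φ⁻¹`. -/
def oneFormInChart (α : (x : M) → TangentSpace (𝓡 n) x →L[ℝ] ℝ)
    (φ : OpenPartialHomeomorph M (Rn n)) (y : Rn n) : Rn n →L[ℝ] ℝ :=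
  (α (φ.symm y)).comp (mfderiv 𝓘(ℝ, Rn n) (𝓡 n) φ.symm y)

/-- `α` is a smooth `1`-form on the open set `U`. -/
def SmoothOneFormOn (α : (x : M) → TangentSpace (𝓡 n) x →L[ℝ] ℝ) (U : Set M) : Prop :=
  ∀ φ ∈ IsManifold.maximalAtlas (𝓡 n) ∞ M,
    ContDiffOn ℝ ∞ (oneFormInChart α φ) (φ.target ∩ φ.symm ⁻¹' U)

/-- `(A, α)` is a smooth section of `D` over the open set `U`. -/
structure IsSectionOn (D : PairFamily (𝓡 n) M) (A : (x : M) → TangentSpace (𝓡 n) x)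
    (α : (x : M) → TangentSpace (𝓡 n) x →L[ℝ] ℝ) (U : Set M) : Prop where
  smooth_fst : SmoothFieldOn A U
  smooth_snd : SmoothOneFormOn α U
  mem : ∀ x ∈ U, (A x, α x) ∈ D x

end Forms

section Submanifolds

variable {n : ℕ} (k : ℕ) {M : Type*} [TopologicalSpace M] [ChartedSpace (Rn n) M]
  [IsManifold (𝓡 n) ∞ M]
  {N : Type*} [TopologicalSpace N] [ChartedSpace (Rn k) N]

/-- The tangent space `T_q N`, seen as a subspace of the tangent space of `M` at `ι q`. -/
def tangentSub (ι : N → M) (q : N) : Submodule ℝ (TangentSpace (𝓡 n) (ι q)) :=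
  LinearMap.range (mfderiv (𝓡 k) (𝓡 n) ι q : TangentSpace (𝓡 k) q →ₗ[ℝ] TangentSpace (𝓡 n) (ι q))

/-- `ν` is a normal bundle of `N` in `M`: a smooth vector subbundle of `T_N M` (it has local smooth
frames along `N`) such that `T_N M = ν ⊕ TN`. -/
structure IsNormalBundle (ι : N → M) (ν : (q : N) → Submodule ℝ (TangentSpace (𝓡 n) (ι q))) :
    Prop where
  isCompl : ∀ q, IsCompl (ν q) (tangentSub k ι q)
  smooth : ∀ q₀ : N, ∃ U : Set N, IsOpen U ∧ q₀ ∈ U ∧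
    ∃ V : Fin (n - k) → (q : N) → TangentSpace (𝓡 n) (ι q),
      (∀ a, ContMDiffOn (𝓡 k) (𝓡 n).tangent ∞
        (fun q => (⟨ι q, V a q⟩ : TangentBundle (𝓡 n) M)) U) ∧
      ∀ q ∈ U, ν q = Submodule.span ℝ (range fun a => V a q)

/-- The total space of a normal bundle, as a subset of `TM`. -/
def totalSet (ι : N → M) (ν : (q : N) → Submodule ℝ (TangentSpace (𝓡 n) (ι q))) :
    Set (TangentBundle (𝓡 n) M) :=
  {p | ∃ q : N, ∃ v ∈ ν q, p = ⟨ι q, v⟩}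

/-- `(N, ν)` is properly normalized in `(M, D)`: along `N`, if `(A, α) ∈ D` then
`(pr_{TN} A, pr_{T*N} α) ∈ D`, where the projections are those of the decomposition
`T_N M = ν ⊕ TN`. Here `T` is `pr_{TN} A`, and `τ`, which equals `α` on `TN` and `0` on `ν`, is
`pr_{T*N} α`. -/
def ProperlyNormalized (D : PairFamily (𝓡 n) M) (ι : N → M)
    (ν : (q : N) → Submodule ℝ (TangentSpace (𝓡 n) (ι q))) : Prop :=
  ∀ q : N, ∀ (A : TangentSpace (𝓡 n) (ι q)) (α : TangentSpace (𝓡 n) (ι q) →L[ℝ] ℝ),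
    (A, α) ∈ D (ι q) →
    ∀ T ∈ tangentSub k ι q, A - T ∈ ν q →
    ∀ τ : TangentSpace (𝓡 n) (ι q) →L[ℝ] ℝ,
      (∀ Y ∈ tangentSub k ι q, τ Y = α Y) → (∀ Z ∈ ν q, τ Z = 0) →
      (T, τ) ∈ D (ι q)

/-- `(A, α)` is, over the open set `U` of `M`, a smooth section of `D` with values in `TN ⊕ T*N`
along `N` (with `T*N` identified with the annihilator of `ν`). -/
structure IsTangentialSectionOn (D : PairFamily (𝓡 n) M) (ι : N → M)
    (ν : (q : N) → Submodule ℝ (TangentSpace (𝓡 n) (ι q)))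
    (A : (x : M) → TangentSpace (𝓡 n) x) (α : (x : M) → TangentSpace (𝓡 n) x →L[ℝ] ℝ)
    (U : Set M) : Prop where
  isSection : IsSectionOn D A α U
  tangent : ∀ q, ι q ∈ U → A (ι q) ∈ tangentSub k ι q
  cotangent : ∀ q, ι q ∈ U → ∀ Z ∈ ν q, α (ι q) Z = 0

/-- The value `Z(α(B)) - α([Z, B]) + β([Z, A])` at `x` of the second fundamental form on the pairs
`(A, α)`, `(B, β)` and the vector `Z`, computed with extensions of these to vector fields and
`1`-forms around `x`. -/
def secondFundamentalValue (A B Z : (x : M) → TangentSpace (𝓡 n) x)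
    (α β : (x : M) → TangentSpace (𝓡 n) x →L[ℝ] ℝ) (x : M) : ℝ :=
  derivAlong (fun y => α y (B y)) x (Z x)
    - α x (VectorField.mlieBracket (𝓡 n) Z B x)
    + β x (VectorField.mlieBracket (𝓡 n) Z A x)

/-- The second fundamental form of `(N, ν)` in `(M, D)` is zero. Its value at a point of `N` does
not depend on the extensions, and only their germs at the point enter, so extensions to arbitrary
open neighbourhoods in `M` of the point are used. -/
def SecondFundamentalFormVanishes (D : PairFamily (𝓡 n) M) (ι : N → M)
    (ν : (q : N) → Submodule ℝ (TangentSpace (𝓡 n) (ι q))) : Prop :=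
  ∀ (q : N) (U : Set M), IsOpen U → ι q ∈ U →
    ∀ (A B Z : (x : M) → TangentSpace (𝓡 n) x) (α β : (x : M) → TangentSpace (𝓡 n) x →L[ℝ] ℝ),
      IsTangentialSectionOn k D ι ν A α U → IsTangentialSectionOn k D ι ν B β U →
      SmoothFieldOn Z U → (∀ q', ι q' ∈ U → Z (ι q') ∈ ν q') →
      secondFundamentalValue A B Z α β (ι q) = 0

/-- `(N, ν)` is properly normalized in `(M, D)` and its second fundamental form is zero. -/
def IsTotallyDiracWith (D : PairFamily (𝓡 n) M) (ι : N → M)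
    (ν : (q : N) → Submodule ℝ (TangentSpace (𝓡 n) (ι q))) : Prop :=
  ProperlyNormalized k D ι ν ∧ SecondFundamentalFormVanishes k D ι ν

/-- `N` is a totally Dirac submanifold of `(M, D)`. -/
def IsTotallyDirac (D : PairFamily (𝓡 n) M) (ι : N → M) : Prop :=
  ∃ ν : (q : N) → Submodule ℝ (TangentSpace (𝓡 n) (ι q)),
    IsNormalBundle k ι ν ∧ IsTotallyDiracWith k D ι ν

/-- A chart `φ = (x, y)` of `M` adapted to `(N, ν)`: the first `k` coordinates are the `xᵘ`, the
others are the `yᵃ`, `N` has the equations `yᵃ = 0`, and `ν` is spanned by the `∂/∂yᵃ` along `N`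
(that is, `ν` consists of the vectors `Z` with all `dxᵘ(Z) = 0`). -/
structure IsAdaptedChart (ι : N → M) (ν : (q : N) → Submodule ℝ (TangentSpace (𝓡 n) (ι q)))
    (φ : OpenPartialHomeomorph M (Rn n)) : Prop where
  mem_atlas : φ ∈ IsManifold.maximalAtlas (𝓡 n) ∞ M
  slice : ∀ x ∈ φ.source, x ∈ range ι ↔ ∀ i : Fin n, k ≤ (i : ℕ) → φ x i = 0
  normal : ∀ q, ι q ∈ φ.source → ∀ Z : TangentSpace (𝓡 n) (ι q),
    Z ∈ ν q ↔ ∀ u : Fin n, (u : ℕ) < k → derivAlong (fun x => φ x u) (ι q) Z = 0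

/-- In the chart `φ = (x, y)`, the mixed components `σ(∂/∂xᵘ, ∂/∂yᵃ)` and the derivatives
`∂σ(∂/∂xᵘ, ∂/∂xˢ)/∂yᵃ` are zero along `N`. -/
def LocalConditions (σ : TwoForm (𝓡 n) M) (ι : N → M) (φ : OpenPartialHomeomorph M (Rn n)) :
    Prop :=
  ∀ q : N, ι q ∈ φ.source → ∀ u a : Fin n, (u : ℕ) < k → k ≤ (a : ℕ) →
    σ.component φ u a (φ (ι q)) = 0 ∧
    ∀ s : Fin n, (s : ℕ) < k →
      fderiv ℝ (σ.component φ u s) (φ (ι q)) (EuclideanSpace.single a 1) = 0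

end Submanifolds

end DiracGeom

end

noncomputable section

set_option linter.unusedSectionVars false

namespace DiracGeom

/-! ### Charts of `M` and the natural coordinates they induce on `TM`. -/

section Charts

variable {n : ℕ} {M : Type*} [TopologicalSpace M] [ChartedSpace (Rn n) M] [IsManifold (𝓡 n) ∞ M]
  {φ ψ : OpenPartialHomeomorph M (Rn n)}

/-! In an adapted chart `N` is the horizontal plane `y = 0` and `ν` consists of the vertical vectors
along it. Every condition of the proposition then reduces to one pointwise condition, `FlatAt`, on
the local expression `s` of `σ`: at points of `N`, horizontal and vertical vectors are
`s`-orthogonal, and vertical derivatives of `s` vanish on pairs of horizontal vectors.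

For the complete lift: the total space of `ν` is horizontal × vertical in natural coordinates, hence
so are its tangent spaces (`dnatCoord_mem`, `exists_mem_subsetTangent`). On them `σ^C` at `(x, v)`
is `(∂_v s)(ξ, ξ') + s(η, ξ') + s(ξ, η')` with `v, η, η'` vertical and `ξ, ξ'` horizontal. Taking `v
= 0`, or `η = η' = 0`, separates the two halves of `FlatAt`.

For the Dirac conditions: proper normalization of a graph amounts to orthogonality of `TN` and `ν`.
In a chart the derivatives of `A` and `B` cancel in the second fundamental form, which becomes the
Lie derivative of `σ` along `Z`, namely `(∂_Z s)(A, B) + s(A, DZ·B) + s(DZ·A, B)`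
(`secondFundamentalValue_eq`). Since `Z` is vertical along `N`, `DZ` sends horizontal vectors to
vertical ones, so orthogonality leaves only the first term. Constant coordinate fields give the
converse.

Passing from "every adapted chart" to "some adapted chart around each point" requires that adapted
charts exist (`exists_adaptedChart`); this comes from the inverse function theorem applied to
`ruledMap`. -/

theorem contMDiffOn_chart (hφ : φ ∈ IsManifold.maximalAtlas (𝓡 n) ∞ M) :
    ContMDiffOn (𝓡 n) 𝓘(ℝ, Rn n) ∞ φ φ.source :=
  contMDiffOn_of_mem_maximalAtlas hφ

theorem contMDiffOn_chart_symm (hφ : φ ∈ IsManifold.maximalAtlas (𝓡 n) ∞ M) :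
    ContMDiffOn 𝓘(ℝ, Rn n) (𝓡 n) ∞ φ.symm φ.target :=
  contMDiffOn_symm_of_mem_maximalAtlas hφ

theorem mdifferentiable_chart (hφ : φ ∈ IsManifold.maximalAtlas (𝓡 n) ∞ M) :
    φ.MDifferentiable (𝓡 n) 𝓘(ℝ, Rn n) :=
  ⟨(contMDiffOn_chart hφ).mdifferentiableOn (by simp),
    (contMDiffOn_chart_symm hφ).mdifferentiableOn (by simp)⟩

/-- The derivative of a chart `φ` at `x`. -/
def dchart (φ : OpenPartialHomeomorph M (Rn n)) (x : M) : TangentSpace (𝓡 n) x →L[ℝ] Rn n :=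
  mfderiv (𝓡 n) 𝓘(ℝ, Rn n) φ x

/-- The derivative of the inverse of a chart `φ` at `y`. -/
def dchartSymm (φ : OpenPartialHomeomorph M (Rn n)) (y : Rn n) :
    Rn n →L[ℝ] TangentSpace (𝓡 n) (φ.symm y) :=
  mfderiv 𝓘(ℝ, Rn n) (𝓡 n) φ.symm y

theorem dchartSymm_dchart (hφ : φ ∈ IsManifold.maximalAtlas (𝓡 n) ∞ M) {x : M}
    (hx : x ∈ φ.source) (v : TangentSpace (𝓡 n) x) : dchartSymm φ (φ x) (dchart φ x v) = v :=
  DFunLike.congr_fun ((mdifferentiable_chart hφ).symm_comp_deriv hx) v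

theorem dchart_dchartSymm (hφ : φ ∈ IsManifold.maximalAtlas (𝓡 n) ∞ M) {y : Rn n}
    (hy : y ∈ φ.target) (ξ : Rn n) : dchart φ (φ.symm y) (dchartSymm φ y ξ) = ξ :=
  DFunLike.congr_fun ((mdifferentiable_chart hφ).comp_symm_deriv hy) ξ

theorem dchart_injective (hφ : φ ∈ IsManifold.maximalAtlas (𝓡 n) ∞ M) {x : M}
    (hx : x ∈ φ.source) : Function.Injective (dchart φ x) :=
  ((mdifferentiable_chart hφ).mfderiv_bijective hx).1

theorem dchart_surjective (hφ : φ ∈ IsManifold.maximalAtlas (𝓡 n) ∞ M) {x : M}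
    (hx : x ∈ φ.source) : Function.Surjective (dchart φ x) :=
  ((mdifferentiable_chart hφ).mfderiv_bijective hx).2

theorem natCoord_mk (φ : OpenPartialHomeomorph M (Rn n)) (x : M) (v : TangentSpace (𝓡 n) x) :
    natCoord φ ⟨x, v⟩ = (φ x, dchart φ x v) :=
  rfl

/-- The inverse of the natural coordinates on `TM` induced by a chart of `M`. -/
def natCoordSymm (φ : OpenPartialHomeomorph M (Rn n)) (z : Rn n × Rn n) :
    TangentBundle (𝓡 n) M :=
  ⟨φ.symm z.1, dchartSymm φ z.1 z.2⟩

theorem natCoord_natCoordSymm (hφ : φ ∈ IsManifold.maximalAtlas (𝓡 n) ∞ M) {z : Rn n × Rn n}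
    (hz : z.1 ∈ φ.target) : natCoord φ (natCoordSymm φ z) = z :=
  Prod.ext (φ.right_inv hz) (dchart_dchartSymm hφ hz z.2)

theorem natCoordSymm_natCoord (hφ : φ ∈ IsManifold.maximalAtlas (𝓡 n) ∞ M)
    {p : TangentBundle (𝓡 n) M} (hp : p.1 ∈ φ.source) : natCoordSymm φ (natCoord φ p) = p := by
  obtain ⟨x, v⟩ := p
  have h1 : φ.symm (φ x) = x := φ.left_inv hp
  have h2 := dchartSymm_dchart hφ hp v
  exact Bundle.TotalSpace.ext h1 (heq_of_eq h2)

theorem contMDiff_toProd {n : ℕ} : ContMDiff (𝓡 n).tangent 𝓘(ℝ, Rn n × Rn n) ∞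
    (fun p : TangentBundle (𝓡 n) (Rn n) => ((p.1, p.2) : Rn n × Rn n)) :=
  ContMDiff.prodMk_space (Bundle.contMDiff_proj (TangentSpace (𝓡 n)))
    (contMDiff_snd_tangentBundle_modelSpace (Rn n) (𝓡 n))

theorem contMDiff_toProd_symm {n : ℕ} : ContMDiff 𝓘(ℝ, Rn n × Rn n) (𝓡 n).tangent ∞
    (fun z : Rn n × Rn n => (⟨z.1, z.2⟩ : TangentBundle (𝓡 n) (Rn n))) := by
  have h := contMDiff_tangentBundleModelSpaceHomeomorph_symm (I := 𝓡 n) (n := ∞)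
  rw [modelWithCornersSelf_prod]
  exact h

theorem contMDiffOn_natCoord (hφ : φ ∈ IsManifold.maximalAtlas (𝓡 n) ∞ M) :
    ContMDiffOn (𝓡 n).tangent 𝓘(ℝ, Rn n × Rn n) ∞ (natCoord φ) {p | p.1 ∈ φ.source} := by
  have h := (contMDiffOn_chart hφ).contMDiffOn_tangentMapWithin (m := ∞) (by simp)
    φ.open_source.uniqueMDiffOn
  refine (contMDiff_toProd.comp_contMDiffOn h).congr fun p hp => ?_
  simp only [Function.comp, tangentMapWithin, natCoord]
  rw [mfderivWithin_of_isOpen φ.open_source hp]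

theorem contMDiffOn_natCoordSymm (hφ : φ ∈ IsManifold.maximalAtlas (𝓡 n) ∞ M) :
    ContMDiffOn 𝓘(ℝ, Rn n × Rn n) (𝓡 n).tangent ∞ (natCoordSymm φ) {z | z.1 ∈ φ.target} := by
  have h := (contMDiffOn_chart_symm hφ).contMDiffOn_tangentMapWithin (m := ∞) (by simp)
    φ.open_target.uniqueMDiffOn
  refine (h.comp (contMDiff_toProd_symm.contMDiffOn (s := {z : Rn n × Rn n | z.1 ∈ φ.target}))
    (fun z hz => hz)).congr fun z hz => ?_
  simp only [Function.comp, tangentMapWithin, natCoordSymm]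
  rw [mfderivWithin_of_isOpen φ.open_target hz]
  rfl

theorem isOpen_natCoord_source (φ : OpenPartialHomeomorph M (Rn n)) :
    IsOpen {p : TangentBundle (𝓡 n) M | p.1 ∈ φ.source} :=
  φ.open_source.preimage (FiberBundle.continuous_proj (Rn n) (TangentSpace (𝓡 n)))

theorem mdifferentiableAt_natCoord (hφ : φ ∈ IsManifold.maximalAtlas (𝓡 n) ∞ M)
    {p : TangentBundle (𝓡 n) M} (hp : p.1 ∈ φ.source) :
    MDifferentiableAt (𝓡 n).tangent 𝓘(ℝ, Rn n × Rn n) (natCoord φ) p :=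
  ((contMDiffOn_natCoord hφ).contMDiffAt ((isOpen_natCoord_source φ).mem_nhds hp)).mdifferentiableAt
    (by simp)

theorem comp_vecPair {E F : Type*} (f : E → F) (a b : E) : f ∘ ![a, b] = ![f a, f b] := by
  ext i; fin_cases i <;> rfl

theorem inChart_apply (σ : TwoForm (𝓡 n) M) (φ : OpenPartialHomeomorph M (Rn n)) (y ξ η : Rn n) :
    σ.inChart φ y ![ξ, η] = σ (φ.symm y) ![dchartSymm φ y ξ, dchartSymm φ y η] := by
  rw [← comp_vecPair (dchartSymm φ y)]
  rfl

theorem inChart_dchart (σ : TwoForm (𝓡 n) M) (hφ : φ ∈ IsManifold.maximalAtlas (𝓡 n) ∞ M) {x : M}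
    (hx : x ∈ φ.source) (v w : TangentSpace (𝓡 n) x) :
    σ.inChart φ (φ x) ![dchart φ x v, dchart φ x w] = σ x ![v, w] := by
  rw [inChart_apply]
  -- All tangent spaces are `Rn n` by definition. Freeing the base point and the vectors lets the
  -- three equalities be substituted without dependent rewriting.
  have key : ∀ x' : M, x' = x → ∀ a b : Rn n, a = v → b = w → (σ x' : Rn n [⋀^Fin 2]→L[ℝ] ℝ) ![a, b]
      = (σ x : Rn n [⋀^Fin 2]→L[ℝ] ℝ) ![v, w] := by
    rintro x' rfl a b rfl rfl; rfl
  exact key _ (φ.left_inv hx) _ _ (dchartSymm_dchart hφ hx v) (dchartSymm_dchart hφ hx w)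

end Charts

/-! ### Calculus of `2`-forms viewed as bilinear maps. -/

section Calculus

variable {E F : Type*} [NormedAddCommGroup E] [NormedSpace ℝ E]
  [NormedAddCommGroup F] [NormedSpace ℝ F]

/-- An alternating form of degree `2` as a continuous bilinear form. -/
def toBilin : (E [⋀^Fin 2]→L[ℝ] ℝ) →L[ℝ] E →L[ℝ] E →L[ℝ] ℝ :=
  (ContinuousLinearMap.compL ℝ E (E [⋀^Fin 1]→L[ℝ] ℝ) (E →L[ℝ] ℝ)
    (ContinuousAlternatingMap.ofSubsingletonLIE (𝕜 := ℝ) (E := E) (F := ℝ)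
      (0 : Fin 1)).symm.toContinuousLinearEquiv.toContinuousLinearMap) ∘L
    ContinuousAlternatingMap.curryLeftLI.toContinuousLinearMap

theorem toBilin_apply (w : E [⋀^Fin 2]→L[ℝ] ℝ) (a b : E) : toBilin w a b = w ![a, b] := by
  change w (Matrix.vecCons a fun _ => b) = _
  congr 1
  ext i; fin_cases i <;> rfl

theorem toBilin_swap (w : E [⋀^Fin 2]→L[ℝ] ℝ) (a b : E) : toBilin w a b = - toBilin w b a := by
  have h := w.toAlternatingMap.map_swap ![b, a] (i := 0) (j := 1) (by decide)
  have e : (![b, a] ∘ Equiv.swap (0 : Fin 2) 1) = ![a, b] := by ext i; fin_cases i <;> rfl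
  rw [e] at h
  rw [toBilin_apply, toBilin_apply]
  exact h

theorem hasFDerivAt_toBilin (w : F [⋀^Fin 2]→L[ℝ] ℝ) :
    HasFDerivAt (F := F →L[ℝ] F →L[ℝ] ℝ) (fun w : F [⋀^Fin 2]→L[ℝ] ℝ => toBilin w) toBilin w :=
  ContinuousLinearMap.hasFDerivAt (F := F →L[ℝ] F →L[ℝ] ℝ) toBilin

theorem contDiff_toBilin :
    ContDiff ℝ ∞ (F := F →L[ℝ] F →L[ℝ] ℝ) (fun w : F [⋀^Fin 2]→L[ℝ] ℝ => toBilin w) :=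
  ContinuousLinearMap.contDiff (𝕜 := ℝ) (E := F [⋀^Fin 2]→L[ℝ] ℝ) (F := F →L[ℝ] F →L[ℝ] ℝ)
    (n := ∞) toBilin

theorem fderiv_twoForm_apply {s : E → F [⋀^Fin 2]→L[ℝ] ℝ} {a b : E → F} {x : E}
    (hs : DifferentiableAt ℝ s x) (ha : DifferentiableAt ℝ a x) (hb : DifferentiableAt ℝ b x)
    (v : E) :
    fderiv ℝ (fun y => s y ![a y, b y]) x v = fderiv ℝ s x v ![a x, b x] +
      s x ![fderiv ℝ a x v, b x] + s x ![a x, fderiv ℝ b x v] := by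
  have h1 : HasFDerivAt (fun y => toBilin (s y)) (toBilin ∘L fderiv ℝ s x) x :=
    HasFDerivAt.comp (G := F →L[ℝ] F →L[ℝ] ℝ) x (hasFDerivAt_toBilin (s x)) hs.hasFDerivAt
  have h2 := (h1.clm_apply ha.hasFDerivAt).clm_apply hb.hasFDerivAt
  simp only [← toBilin_apply]
  rw [h2.fderiv]
  simp
  ring

theorem contDiffOn_contract {s : E → F [⋀^Fin 2]→L[ℝ] ℝ} {a : E → F} {S : Set E}
    (hs : ContDiffOn ℝ ∞ s S) (ha : ContDiffOn ℝ ∞ a S) :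
    ContDiffOn ℝ ∞ (fun y => toBilin (s y) (a y)) S :=
  ContDiffOn.clm_apply
    (ContDiff.comp_contDiffOn (G := F →L[ℝ] F →L[ℝ] ℝ) contDiff_toBilin hs) ha

end Calculus

/-! ### Naturality of the complete lift under coordinate changes. -/

section CompleteLift

variable {n : ℕ}

/-- The derivative of the tangent map `(y, v) ↦ (τ y, Dτ(y) v)`. -/
theorem hasFDerivAt_tangent {τ : Rn n → Rn n} {y v : Rn n} (hτ : ContDiffAt ℝ 2 τ y) :
    HasFDerivAt (fun z : Rn n × Rn n => (τ z.1, fderiv ℝ τ z.1 z.2))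
      (((fderiv ℝ τ y) ∘L ContinuousLinearMap.fst ℝ (Rn n) (Rn n)).prod
        ((fderiv ℝ τ y) ∘L ContinuousLinearMap.snd ℝ (Rn n) (Rn n) +
          ((fderiv ℝ (fderiv ℝ τ) y).flip v) ∘L ContinuousLinearMap.fst ℝ (Rn n) (Rn n)))
      (y, v) := by
  have h1 : HasFDerivAt τ (fderiv ℝ τ y) (y, v).1 := (hτ.differentiableAt (by simp)).hasFDerivAt
  have h2 : HasFDerivAt (fderiv ℝ τ) (fderiv ℝ (fderiv ℝ τ) y) (y, v).1 :=
    ((hτ.fderiv_right (m := 1) (by norm_num)).differentiableAt (by simp)).hasFDerivAt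
  have h3 := (h2.comp (y, v) hasFDerivAt_fst).clm_apply (hasFDerivAt_snd (p := (y, v)))
  have h4 := (h1.comp (y, v) hasFDerivAt_fst).prodMk h3
  convert! h4 using 1

/-- Differentiating `t = τ^* s` along `v` produces the extra terms `s(D²τ(v, ξ), Dτ ξ')` and `s(Dτ
ξ, D²τ(v, ξ'))`. The derivative of the tangent map of `τ` produces the same terms through its fibre
component, with the arguments of `D²τ` exchanged; symmetry of `D²τ` matches them. -/
theorem coordCompleteLift_pullback {s t : Rn n → Rn n [⋀^Fin 2]→L[ℝ] ℝ} {τ : Rn n → Rn n}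
    {y v : Rn n} (hτ : ContDiffAt ℝ 2 τ y) (hs : DifferentiableAt ℝ s (τ y))
    (ht : DifferentiableAt ℝ t y)
    (h : ∀ᶠ z in 𝓝 y, ∀ ξ η, t z ![ξ, η] = s (τ z) ![fderiv ℝ τ z ξ, fderiv ℝ τ z η])
    (X Y : Rn n × Rn n) :
    coordCompleteLift t (y, v) ![X, Y] = coordCompleteLift s (τ y, fderiv ℝ τ y v)
      ![fderiv ℝ (fun z : Rn n × Rn n => (τ z.1, fderiv ℝ τ z.1 z.2)) (y, v) X,
        fderiv ℝ (fun z : Rn n × Rn n => (τ z.1, fderiv ℝ τ z.1 z.2)) (y, v) Y] := by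
  obtain ⟨ξ, η⟩ := X
  obtain ⟨ξ', η'⟩ := Y
  have hτ1 : DifferentiableAt ℝ τ y := hτ.differentiableAt (by simp)
  have hτ2 : DifferentiableAt ℝ (fderiv ℝ τ) y :=
    (hτ.fderiv_right (m := 1) (by norm_num)).differentiableAt (by simp)
  have hsymm : ∀ a b, fderiv ℝ (fderiv ℝ τ) y a b = fderiv ℝ (fderiv ℝ τ) y b a :=
    fun a b => (hτ.isSymmSndFDerivAt (by simp)).eq a b
  have ht' : fderiv ℝ t y v ![ξ, ξ'] = fderiv ℝ s (τ y) (fderiv ℝ τ y v)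
        ![fderiv ℝ τ y ξ, fderiv ℝ τ y ξ'] +
      s (τ y) ![fderiv ℝ (fderiv ℝ τ) y v ξ, fderiv ℝ τ y ξ'] +
      s (τ y) ![fderiv ℝ τ y ξ, fderiv ℝ (fderiv ℝ τ) y v ξ'] := by
    rw [← fderiv_continuousAlternatingMap_apply_const_apply ht,
      Filter.EventuallyEq.fderiv_eq (h.mono fun z hz => hz ξ ξ'),
      fderiv_twoForm_apply (s := fun z => s (τ z)) (hs.comp y hτ1)
        (hτ2.clm_apply (differentiableAt_const _))
        (hτ2.clm_apply (differentiableAt_const _))]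
    have e : ∀ c, fderiv ℝ (fun z => fderiv ℝ τ z c) y v = fderiv ℝ (fderiv ℝ τ) y v c := by
      intro c
      rw [(hτ2.hasFDerivAt.clm_apply (hasFDerivAt_const c y)).fderiv]
      simp
    have e2 : fderiv ℝ (fun z => s (τ z)) y = (fderiv ℝ s (τ y)) ∘L fderiv ℝ τ y :=
      (hs.hasFDerivAt.comp y hτ1.hasFDerivAt).fderiv
    rw [e, e]
    congr 3
    change fderiv ℝ (fun z => s (τ z)) y v = _
    rw [e2]; rfl
  rw [(hasFDerivAt_tangent hτ).fderiv]
  simp only [ContinuousLinearMap.prod_apply, ContinuousLinearMap.comp_apply, _root_.add_apply,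
    ContinuousLinearMap.coe_fst', ContinuousLinearMap.coe_snd', ContinuousLinearMap.flip_apply]
  rw [coordCompleteLift_apply, coordCompleteLift_apply, ht', h.self_of_nhds, h.self_of_nhds,
    hsymm v ξ, hsymm v ξ']
  simp only [← toBilin_apply, map_add, _root_.add_apply]
  ring

end CompleteLift

/-! ### Chart changes; the complete lift in an arbitrary chart. -/

section ChartChange

variable {n : ℕ} {M : Type*} [TopologicalSpace M] [ChartedSpace (Rn n) M] [IsManifold (𝓡 n) ∞ M]
  {φ ψ : OpenPartialHomeomorph M (Rn n)}

theorem contDiffAt_chartChange (hφ : φ ∈ IsManifold.maximalAtlas (𝓡 n) ∞ M)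
    (hψ : ψ ∈ IsManifold.maximalAtlas (𝓡 n) ∞ M) {y : Rn n} (hy : y ∈ ψ.target)
    (hy' : ψ.symm y ∈ φ.source) : ContDiffAt ℝ ∞ (φ ∘ ψ.symm) y := by
  rw [← contMDiffAt_iff_contDiffAt]
  exact ((contMDiffOn_chart hφ).contMDiffAt (φ.open_source.mem_nhds hy')).comp y
    ((contMDiffOn_chart_symm hψ).contMDiffAt (ψ.open_target.mem_nhds hy))

theorem fderiv_chartChange (hφ : φ ∈ IsManifold.maximalAtlas (𝓡 n) ∞ M)
    (hψ : ψ ∈ IsManifold.maximalAtlas (𝓡 n) ∞ M) {y : Rn n} (hy : y ∈ ψ.target)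
    (hy' : ψ.symm y ∈ φ.source) (ξ : Rn n) :
    fderiv ℝ (φ ∘ ψ.symm) y ξ = dchart φ (ψ.symm y) (dchartSymm ψ y ξ) := by
  have h := mfderiv_comp y ((mdifferentiable_chart hφ).mdifferentiableAt hy')
    ((mdifferentiable_chart hψ).mdifferentiableAt_symm hy)
  rw [← mfderiv_eq_fderiv]
  exact DFunLike.congr_fun h ξ

theorem fderiv_chartChange_dchart (hφ : φ ∈ IsManifold.maximalAtlas (𝓡 n) ∞ M)
    (hψ : ψ ∈ IsManifold.maximalAtlas (𝓡 n) ∞ M) {x : M} (hx : x ∈ ψ.source)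
    (hx' : x ∈ φ.source) (v : TangentSpace (𝓡 n) x) :
    fderiv ℝ (φ ∘ ψ.symm) (ψ x) (dchart ψ x v) = dchart φ x v := by
  have h1 : φ =ᶠ[𝓝 x] (φ ∘ ψ.symm) ∘ ψ := by
    filter_upwards [ψ.open_source.mem_nhds hx] with z hz
    simp [ψ.left_inv hz]
  have h2 : MDifferentiableAt 𝓘(ℝ, Rn n) 𝓘(ℝ, Rn n) (φ ∘ ψ.symm) (ψ x) :=
    ((contDiffAt_chartChange hφ hψ (ψ.map_source hx)
      (by rwa [ψ.left_inv hx])).differentiableAt (by simp)).mdifferentiableAt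
  have h := mfderiv_comp x h2 ((mdifferentiable_chart hψ).mdifferentiableAt hx)
  rw [← h1.mfderiv_eq, mfderiv_eq_fderiv] at h
  exact (DFunLike.congr_fun h v).symm

theorem eventually_mem_overlap {y : Rn n} (hy : y ∈ ψ.target) (hy' : ψ.symm y ∈ φ.source) :
    ∀ᶠ z in 𝓝 y, z ∈ ψ.target ∧ ψ.symm z ∈ φ.source :=
  (ψ.open_target.eventually_mem hy).and
    ((ψ.continuousAt_symm hy).eventually (φ.open_source.eventually_mem hy'))

theorem inChart_chartChange (σ : TwoForm (𝓡 n) M) (hφ : φ ∈ IsManifold.maximalAtlas (𝓡 n) ∞ M)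
    (hψ : ψ ∈ IsManifold.maximalAtlas (𝓡 n) ∞ M) {y : Rn n} (hy : y ∈ ψ.target)
    (hy' : ψ.symm y ∈ φ.source) (ξ η : Rn n) :
    σ.inChart ψ y ![ξ, η] = σ.inChart φ ((φ ∘ ψ.symm) y)
      ![fderiv ℝ (φ ∘ ψ.symm) y ξ, fderiv ℝ (φ ∘ ψ.symm) y η] := by
  rw [fderiv_chartChange hφ hψ hy hy', fderiv_chartChange hφ hψ hy hy', inChart_apply]
  exact (inChart_dchart σ hφ hy' _ _).symm

/-- The derivative of the natural coordinates on `TM` induced by a chart of `M`. -/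
def dnatCoord (φ : OpenPartialHomeomorph M (Rn n)) (p : TangentBundle (𝓡 n) M) :
    TangentSpace (𝓡 n).tangent p →L[ℝ] Rn n × Rn n :=
  mfderiv (𝓡 n).tangent 𝓘(ℝ, Rn n × Rn n) (natCoord φ) p

theorem differentiableAt_inChart {σ : TwoForm (𝓡 n) M} (hσ : IsPresymplectic σ)
    (hφ : φ ∈ IsManifold.maximalAtlas (𝓡 n) ∞ M) {y : Rn n} (hy : y ∈ φ.target) :
    DifferentiableAt ℝ (σ.inChart φ) y :=
  ((hσ.smooth φ hφ).contDiffAt (φ.open_target.mem_nhds hy)).differentiableAt (by simp)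

/-- This frees `σ^C` from the preferred chart at the base point, so that it can be computed in an
adapted chart. It is `coordCompleteLift_pullback` for the transition map `φ ∘ ψ.symm`, whose tangent
map relates the two natural coordinate systems. -/
theorem completeLift_apply {σ : TwoForm (𝓡 n) M} (hσ : IsPresymplectic σ)
    (hφ : φ ∈ IsManifold.maximalAtlas (𝓡 n) ∞ M) {p : TangentBundle (𝓡 n) M} (hp : p.1 ∈ φ.source)
    (A B : TangentSpace (𝓡 n).tangent p) :
    σ.completeLift p ![A, B] = coordCompleteLift (σ.inChart φ) (natCoord φ p)
      ![dnatCoord φ p A, dnatCoord φ p B] := by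
  set ψ := chartAt (Rn n) p.1 with hψ_def
  have hψ : ψ ∈ IsManifold.maximalAtlas (𝓡 n) ∞ M := IsManifold.chart_mem_maximalAtlas p.1
  have hpψ : p.1 ∈ ψ.source := mem_chart_source _ _
  have h0 : σ.completeLift p ![A, B] = coordCompleteLift (σ.inChart ψ) (natCoord ψ p)
      ![dnatCoord ψ p A, dnatCoord ψ p B] := by
    rw [← comp_vecPair (dnatCoord ψ p)]
    rfl
  have hy : ψ p.1 ∈ ψ.target := ψ.map_source hpψ
  have hy' : ψ.symm (ψ p.1) ∈ φ.source := by rwa [ψ.left_inv hpψ]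
  have hτ := contDiffAt_chartChange hφ hψ hy hy'
  have hτ2 : ContDiffAt ℝ 2 (φ ∘ ψ.symm) (ψ p.1) := hτ.of_le ENat.LEInfty.out
  have hτp : (φ ∘ ψ.symm) (ψ p.1) = φ p.1 := by simp [ψ.left_inv hpψ]
  have hnat : natCoord φ =ᶠ[𝓝 p] (fun z : Rn n × Rn n => ((φ ∘ ψ.symm) z.1,
      fderiv ℝ (φ ∘ ψ.symm) z.1 z.2)) ∘ natCoord ψ := by
    filter_upwards [(isOpen_natCoord_source φ).mem_nhds hp,
      (isOpen_natCoord_source ψ).mem_nhds hpψ] with q hq hqψ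
    obtain ⟨x, v⟩ := q
    simp only [natCoord_mk, Function.comp_def, Prod.mk.injEq]
    refine ⟨by rw [ψ.left_inv hqψ], (fderiv_chartChange_dchart hφ hψ hqψ hq v).symm⟩
  have hd : ∀ C : TangentSpace (𝓡 n).tangent p, dnatCoord φ p C =
      fderiv ℝ (fun z : Rn n × Rn n => ((φ ∘ ψ.symm) z.1, fderiv ℝ (φ ∘ ψ.symm) z.1 z.2))
        (ψ p.1, dchart ψ p.1 p.2) (dnatCoord ψ p C) := by
    intro C
    have h := mfderiv_comp p
      (hasFDerivAt_tangent (v := dchart ψ p.1 p.2) hτ2).differentiableAt.mdifferentiableAt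
      (mdifferentiableAt_natCoord hψ hpψ)
    rw [← hnat.mfderiv_eq, mfderiv_eq_fderiv] at h
    exact DFunLike.congr_fun h C
  have key := coordCompleteLift_pullback (s := σ.inChart φ) (t := σ.inChart ψ)
    (v := dchart ψ p.1 p.2) hτ2
    (by rw [hτp]; exact differentiableAt_inChart hσ hφ (φ.map_source hp))
    (differentiableAt_inChart hσ hψ hy)
    ((eventually_mem_overlap hy hy').mono fun z hz ξ η =>
      inChart_chartChange σ hφ hψ hz.1 hz.2 ξ η) (dnatCoord ψ p A) (dnatCoord ψ p B)
  rw [h0, hd, hd]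
  have e : natCoord φ p =
      ((φ ∘ ψ.symm) (ψ p.1), fderiv ℝ (φ ∘ ψ.symm) (ψ p.1) (dchart ψ p.1 p.2)) :=
    hnat.self_of_nhds
  rw [e]
  exact key

end ChartChange

/-! ### The horizontal and vertical subspaces of `ℝⁿ`. -/

section Coordinates

variable {n : ℕ}

/-- The span of the first `k` coordinate directions of `ℝⁿ`. -/
def horizontal (k n : ℕ) : Submodule ℝ (Rn n) where
  carrier := {ξ | ∀ i : Fin n, k ≤ (i : ℕ) → ξ i = 0}
  add_mem' := by
    intro a b ha hb i hi
    simp [ha i hi, hb i hi]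
  zero_mem' := by intro i _; rfl
  smul_mem' := by
    intro c a ha i hi
    simp [ha i hi]

/-- The span of the last `n - k` coordinate directions of `ℝⁿ`. -/
def vertical (k n : ℕ) : Submodule ℝ (Rn n) where
  carrier := {ξ | ∀ i : Fin n, (i : ℕ) < k → ξ i = 0}
  add_mem' := by
    intro a b ha hb i hi
    simp [ha i hi, hb i hi]
  zero_mem' := by intro i _; rfl
  smul_mem' := by
    intro c a ha i hi
    simp [ha i hi]

theorem mem_vertical {k : ℕ} {ξ : Rn n} :
    ξ ∈ vertical k n ↔ ∀ i : Fin n, (i : ℕ) < k → ξ i = 0 := Iff.rfl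

theorem single_mem_horizontal {k : ℕ} {i : Fin n} (hi : (i : ℕ) < k) :
    EuclideanSpace.single i (1 : ℝ) ∈ horizontal k n := by
  intro j hj
  have : j ≠ i := by rintro rfl; omega
  simp [this]

theorem single_mem_vertical {k : ℕ} {i : Fin n} (hi : k ≤ (i : ℕ)) :
    EuclideanSpace.single i (1 : ℝ) ∈ vertical k n := by
  intro j hj
  have : j ≠ i := by rintro rfl; omega
  simp [this]

/-- The projection of `ℝⁿ` onto its first `k` coordinate directions. -/
def horizontalProj (k n : ℕ) : Rn n →L[ℝ] Rn n :=
  LinearMap.toContinuousLinearMap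
    { toFun := fun ξ => WithLp.toLp 2 fun i => if (i : ℕ) < k then ξ i else 0
      map_add' := by
        intro a b; ext i; by_cases h : (i : ℕ) < k <;> simp [h]
      map_smul' := by
        intro c a; ext i; by_cases h : (i : ℕ) < k <;> simp [h] }

theorem horizontalProj_apply (k : ℕ) (ξ : Rn n) (i : Fin n) :
    horizontalProj k n ξ i = if (i : ℕ) < k then ξ i else 0 := rfl

theorem horizontalProj_of_mem {k : ℕ} {ξ : Rn n} (h : ξ ∈ horizontal k n) :
    horizontalProj k n ξ = ξ := by
  ext i
  rw [horizontalProj_apply]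
  split_ifs with hi
  · rfl
  · exact (h i (by omega)).symm

theorem horizontalProj_of_mem_vertical {k : ℕ} {ξ : Rn n} (h : ξ ∈ vertical k n) :
    horizontalProj k n ξ = 0 := by
  ext i
  rw [horizontalProj_apply]
  split_ifs with hi
  · exact h i hi
  · rfl

/-- The `i`-th coordinate on `ℝⁿ`. -/
def coordProj (i : Fin n) : Rn n →L[ℝ] ℝ := EuclideanSpace.proj i

theorem clm_apply_eq_sum (f : Rn n →L[ℝ] ℝ) (ξ : Rn n) :
    f ξ = ∑ i, ξ i * f (EuclideanSpace.single i 1) := by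
  conv_lhs => rw [← (EuclideanSpace.basisFun (Fin n) ℝ).sum_repr ξ]
  simp

theorem clm_eq_zero_of_mem_horizontal {k : ℕ} {f : Rn n →L[ℝ] ℝ}
    (hf : ∀ i : Fin n, (i : ℕ) < k → f (EuclideanSpace.single i 1) = 0) {ξ : Rn n}
    (hξ : ξ ∈ horizontal k n) : f ξ = 0 := by
  rw [clm_apply_eq_sum]
  refine Finset.sum_eq_zero fun i _ => ?_
  rcases lt_or_ge (i : ℕ) k with hi | hi
  · rw [hf i hi, mul_zero]
  · rw [hξ i hi, zero_mul]

theorem clm_eq_zero_of_mem_vertical {k : ℕ} {f : Rn n →L[ℝ] ℝ}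
    (hf : ∀ i : Fin n, k ≤ (i : ℕ) → f (EuclideanSpace.single i 1) = 0) {ξ : Rn n}
    (hξ : ξ ∈ vertical k n) : f ξ = 0 := by
  rw [clm_apply_eq_sum]
  refine Finset.sum_eq_zero fun i _ => ?_
  rcases lt_or_ge (i : ℕ) k with hi | hi
  · rw [hξ i hi, zero_mul]
  · rw [hf i hi, mul_zero]

/-- At the point `y`, the splitting of `ℝⁿ` is orthogonal for the `2`-form `s`, and the derivatives
of `s` in the vertical directions vanish on horizontal vectors. -/
def FlatAt (k : ℕ) (s : Rn n → Rn n [⋀^Fin 2]→L[ℝ] ℝ) (y : Rn n) : Prop :=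
  (∀ ξ ∈ horizontal k n, ∀ η ∈ vertical k n, s y ![ξ, η] = 0) ∧
  ∀ ξ ∈ horizontal k n, ∀ ξ' ∈ horizontal k n, ∀ η ∈ vertical k n, fderiv ℝ s y η ![ξ, ξ'] = 0

end Coordinates

/-! ### Adapted charts, and isotropy of the total space of `ν`. -/

section AdaptedChart

variable {n k : ℕ} {M : Type*} [TopologicalSpace M] [ChartedSpace (Rn n) M]
  [IsManifold (𝓡 n) ∞ M] {N : Type*} [TopologicalSpace N] [ChartedSpace (Rn k) N]
  {φ : OpenPartialHomeomorph M (Rn n)} {σ : TwoForm (𝓡 n) M} {ι : N → M}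
  {ν : (q : N) → Submodule ℝ (TangentSpace (𝓡 n) (ι q))}

/-- Bilinearity, and linearity in the direction of differentiation, pass from coordinate vectors to
the subspaces they span. -/
theorem localConditions_iff (hσ : IsPresymplectic σ)
    (hφ : φ ∈ IsManifold.maximalAtlas (𝓡 n) ∞ M) :
    LocalConditions k σ ι φ ↔
      ∀ q, ι q ∈ φ.source → FlatAt k (σ.inChart φ) (φ (ι q)) := by
  -- The coordinate vectors are constant, so differentiating a component is the same as taking a
  -- component of the derivative.
  have hd : ∀ q, ι q ∈ φ.source → ∀ (u s : Fin n) (v : Rn n),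
      fderiv ℝ (σ.component φ u s) (φ (ι q)) v = fderiv ℝ (σ.inChart φ) (φ (ι q)) v
        ![EuclideanSpace.single u 1, EuclideanSpace.single s 1] := by
    intro q hq u s v
    exact fderiv_continuousAlternatingMap_apply_const_apply
      (differentiableAt_inChart hσ hφ (φ.map_source hq)) _ v
  constructor
  · intro h q hq
    refine ⟨fun ξ hξ η hη => ?_, fun ξ hξ ξ' hξ' η hη => ?_⟩
    · rw [← toBilin_apply]
      refine clm_eq_zero_of_mem_vertical (fun a ha => ?_) hη
      rw [toBilin_swap, neg_eq_zero]
      refine clm_eq_zero_of_mem_horizontal (fun u hu => ?_) hξ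
      rw [toBilin_swap, toBilin_apply, neg_eq_zero]
      exact (h q hq u a hu ha).1
    · have h1 : ∀ u s : Fin n, (u : ℕ) < k → (s : ℕ) < k → fderiv ℝ (σ.inChart φ) (φ (ι q)) η
          ![EuclideanSpace.single u 1, EuclideanSpace.single s 1] = 0 := by
        intro u s hu hs
        rw [← hd q hq]
        exact clm_eq_zero_of_mem_vertical (fun a ha => (h q hq u a hu ha).2 s hs) hη
      rw [← toBilin_apply]
      refine clm_eq_zero_of_mem_horizontal (fun s hs => ?_) hξ'
      rw [toBilin_swap, neg_eq_zero]
      refine clm_eq_zero_of_mem_horizontal (fun u hu => ?_) hξ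
      rw [toBilin_swap, toBilin_apply, neg_eq_zero]
      exact h1 u s hu hs
  · intro h q hq u a hu ha
    refine ⟨(h q hq).1 _ (single_mem_horizontal hu) _ (single_mem_vertical ha), fun s hs => ?_⟩
    rw [hd q hq]
    exact (h q hq).2 _ (single_mem_horizontal hu) _ (single_mem_horizontal hs) _
      (single_mem_vertical ha)

theorem derivAlong_coord (hφ : φ ∈ IsManifold.maximalAtlas (𝓡 n) ∞ M) {x : M} (hx : x ∈ φ.source)
    (i : Fin n) (Z : TangentSpace (𝓡 n) x) :
    derivAlong (fun x => φ x i) x Z = dchart φ x Z i := by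
  have h := mfderiv_comp x ((coordProj i).differentiableAt.mdifferentiableAt)
    ((mdifferentiable_chart hφ).mdifferentiableAt hx)
  rw [mfderiv_eq_fderiv, ContinuousLinearMap.fderiv] at h
  exact DFunLike.congr_fun h Z

namespace IsAdaptedChart

theorem mem_normal_iff (h : IsAdaptedChart k ι ν φ) {q : N} (hq : ι q ∈ φ.source)
    (Z : TangentSpace (𝓡 n) (ι q)) : Z ∈ ν q ↔ dchart φ (ι q) Z ∈ vertical k n := by
  rw [h.normal q hq, mem_vertical]
  exact forall₂_congr fun u _ => by rw [derivAlong_coord h.mem_atlas hq]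

/-- The functions `yᵃ ∘ ι` vanish near `q`, hence so do their differentials at `q`. -/
theorem dchart_mem_horizontal (h : IsAdaptedChart k ι ν φ) (hι : ContMDiff (𝓡 k) (𝓡 n) ∞ ι) {q : N}
    (hq : ι q ∈ φ.source) {Z : TangentSpace (𝓡 n) (ι q)} (hZ : Z ∈ tangentSub k ι q) :
    dchart φ (ι q) Z ∈ horizontal k n := by
  obtain ⟨w, rfl⟩ := hZ
  intro i hi
  have hmd : MDifferentiableAt (𝓡 k) (𝓡 n) ι q := (hι q).mdifferentiableAt (by simp)
  have h1 := mfderiv_comp q ((coordProj i).differentiableAt.mdifferentiableAt)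
    (((mdifferentiable_chart h.mem_atlas).mdifferentiableAt hq).comp q hmd)
  rw [mfderiv_comp q ((mdifferentiable_chart h.mem_atlas).mdifferentiableAt hq) hmd,
    mfderiv_eq_fderiv, ContinuousLinearMap.fderiv] at h1
  have h2 : ((coordProj i) ∘ φ ∘ ι) =ᶠ[𝓝 q]
      fun _ => (0 : ℝ) := by
    filter_upwards [(hι q).continuousAt.eventually (φ.open_source.eventually_mem hq)] with q' hq'
    exact (h.slice _ hq').1 (mem_range_self _) i hi
  rw [h2.mfderiv_eq, mfderiv_const] at h1
  exact (DFunLike.congr_fun h1 w).symm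

/-- No dimension count is needed for the converse: the `ν`-component of a vector with horizontal
image has an image that is both horizontal and vertical, so it is zero. -/
theorem mem_tangentSub_iff (h : IsAdaptedChart k ι ν φ) (hι : ContMDiff (𝓡 k) (𝓡 n) ∞ ι)
    (hν : IsNormalBundle k ι ν) {q : N}
    (hq : ι q ∈ φ.source) (Z : TangentSpace (𝓡 n) (ι q)) :
    Z ∈ tangentSub k ι q ↔ dchart φ (ι q) Z ∈ horizontal k n := by
  refine ⟨h.dchart_mem_horizontal hι hq, fun hZ => ?_⟩
  have hsup : Z ∈ ν q ⊔ tangentSub k ι q := by rw [(hν.isCompl q).sup_eq_top]; trivial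
  obtain ⟨Z₁, hZ₁, Z₂, hZ₂, rfl⟩ := Submodule.mem_sup.1 hsup
  have h2 := h.dchart_mem_horizontal hι hq hZ₂
  have h1 := (h.mem_normal_iff hq Z₁).1 hZ₁
  have h1' : dchart φ (ι q) Z₁ ∈ horizontal k n := by
    rw [map_add] at hZ
    exact (Submodule.add_mem_iff_left _ h2).1 hZ
  have : dchart φ (ι q) Z₁ = 0 := by
    ext i
    rcases lt_or_ge (i : ℕ) k with hi | hi
    · exact h1 i hi
    · exact h1' i hi
  have hz : Z₁ = 0 := dchart_injective h.mem_atlas hq (by rw [this, map_zero])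
  rw [hz, zero_add]
  exact hZ₂

theorem mem_range_iff (h : IsAdaptedChart k ι ν φ) {x : M} (hx : x ∈ φ.source) :
    x ∈ range ι ↔ φ x ∈ horizontal k n :=
  h.slice x hx

theorem mem_totalSet_iff (h : IsAdaptedChart k ι ν φ) {p : TangentBundle (𝓡 n) M}
    (hp : p.1 ∈ φ.source) :
    p ∈ totalSet ι ν ↔ (natCoord φ p).1 ∈ horizontal k n ∧ (natCoord φ p).2 ∈ vertical k n := by
  constructor
  · rintro ⟨q, v, hv, rfl⟩
    exact ⟨(h.mem_range_iff hp).1 (mem_range_self q), (h.mem_normal_iff hp v).1 hv⟩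
  · obtain ⟨x, v⟩ := p
    rintro ⟨h1, h2⟩
    obtain ⟨q, rfl⟩ := (h.mem_range_iff hp).2 h1
    exact ⟨q, v, (h.mem_normal_iff hp v).2 h2, rfl⟩

end IsAdaptedChart

/-- Over each `A` the graph contains exactly one covector, the contraction of the form with `A`. -/
theorem isIsotropic_graphOf_iff {E H : Type*} [NormedAddCommGroup E] [NormedSpace ℝ E]
    [TopologicalSpace H] {I : ModelWithCorners ℝ E H} {X : Type*}
    [TopologicalSpace X] [ChartedSpace H X] {S : Set X} {w : TwoForm I X} :
    IsIsotropic I S (graphOf w) ↔ ∀ p ∈ S, ∀ A ∈ subsetTangent I S p, ∀ B ∈ subsetTangent I S p,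
      w p ![A, B] = 0 := by
  constructor
  · intro h p hp A hA B hB
    have key : ∀ (e : E [⋀^Fin 2]→L[ℝ] ℝ) (a : E), ∃ f : E →L[ℝ] ℝ, ∀ b, f b = e ![a, b] :=
      fun e a => ⟨toBilin e a, toBilin_apply e a⟩
    obtain ⟨f, hf⟩ := key (w p) A
    have := h p hp A hA f hf B hB
    exact (hf B).symm.trans this
  · intro h p hp A hA α hα B hB
    rw [show α B = w p ![A, B] from hα B]
    exact h p hp A hA B hB

theorem dnatCoord_mfderiv (hφ : φ ∈ IsManifold.maximalAtlas (𝓡 n) ∞ M)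
    {γ : ℝ → TangentBundle (𝓡 n) M} (hγ : ContMDiffAt 𝓘(ℝ, ℝ) (𝓡 n).tangent ∞ γ 0)
    (hp : (γ 0).1 ∈ φ.source) :
    HasDerivAt (natCoord φ ∘ γ)
      (dnatCoord φ (γ 0) (mfderiv 𝓘(ℝ, ℝ) (𝓡 n).tangent γ 0 (1 : ℝ))) 0 := by
  have h1 := mdifferentiableAt_natCoord hφ hp
  have h2 := hγ.mdifferentiableAt (by simp)
  have h3 := mfderiv_comp 0 h1 h2
  have h4 : DifferentiableAt ℝ (natCoord φ ∘ γ) 0 :=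
    mdifferentiableAt_iff_differentiableAt.1 (h1.comp 0 h2)
  rw [mfderiv_eq_fderiv] at h3
  have h5 : fderiv ℝ (natCoord φ ∘ γ) 0 1 =
      dnatCoord φ (γ 0) (mfderiv 𝓘(ℝ, ℝ) (𝓡 n).tangent γ 0 (1 : ℝ)) :=
    DFunLike.congr_fun h3 (1 : ℝ)
  rw [← h5]
  exact h4.hasFDerivAt.hasDerivAt

theorem clm_apply_deriv_eq_zero {E : Type*} [NormedAddCommGroup E] [NormedSpace ℝ E]
    {f : ℝ → E} {f' : E} {t : ℝ} (hf : HasDerivAt f f' t) (l : E →L[ℝ] ℝ)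
    (h : ∀ᶠ u in 𝓝 t, l (f u) = 0) : l f' = 0 := by
  have h1 : HasDerivAt (fun u => l (f u)) (l f') t := l.hasFDerivAt.comp_hasDerivAt t hf
  have h2 : HasDerivAt (fun u => l (f u)) 0 t :=
    (hasDerivAt_const t (0 : ℝ)).congr_of_eventuallyEq h
  exact h1.unique h2

namespace IsAdaptedChart

/-- In natural coordinates a curve in the total space satisfies linear equations, which its velocity
inherits. The constraint is a subspace, so it passes to the span of velocities. -/
theorem dnatCoord_mem (h : IsAdaptedChart k ι ν φ) {p : TangentBundle (𝓡 n) M}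
    (hp : p.1 ∈ φ.source) {A : TangentSpace (𝓡 n).tangent p}
    (hA : A ∈ subsetTangent (𝓡 n).tangent (totalSet ι ν) p) :
    (dnatCoord φ p A).1 ∈ horizontal k n ∧ (dnatCoord φ p A).2 ∈ vertical k n := by
  suffices hs : subsetTangent (𝓡 n).tangent (totalSet ι ν) p ≤
      ((horizontal k n).prod (vertical k n)).comap (dnatCoord φ p).toLinearMap from hs hA
  refine Submodule.span_le.2 ?_
  rintro v ⟨γ, hγ, hmem, htan⟩
  have h0 : γ 0 = p := congrArg Bundle.TotalSpace.proj htan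
  subst h0
  have hv : mfderiv 𝓘(ℝ, ℝ) (𝓡 n).tangent γ 0 (1 : ℝ) = v :=
    eq_of_heq (Bundle.TotalSpace.mk.inj htan).2
  have hd := dnatCoord_mfderiv h.mem_atlas hγ hp
  rw [hv] at hd
  have hev : ∀ᶠ t in 𝓝 (0 : ℝ), (natCoord φ (γ t)).1 ∈ horizontal k n ∧
      (natCoord φ (γ t)).2 ∈ vertical k n := by
    filter_upwards [hmem, hγ.continuousAt.eventually ((isOpen_natCoord_source φ).eventually_mem hp)]
      with t ht ht'
    exact (h.mem_totalSet_iff ht').1 ht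
  refine ⟨fun i hi => ?_, fun i hi => ?_⟩
  · exact clm_apply_deriv_eq_zero hd ((coordProj i) ∘L
      ContinuousLinearMap.fst ℝ (Rn n) (Rn n)) (hev.mono fun t ht => ht.1 i hi)
  · exact clm_apply_deriv_eq_zero hd ((coordProj i) ∘L
      ContinuousLinearMap.snd ℝ (Rn n) (Rn n)) (hev.mono fun t ht => ht.2 i hi)

theorem exists_mem_subsetTangent (h : IsAdaptedChart k ι ν φ) {p : TangentBundle (𝓡 n) M}
    (hp : p.1 ∈ φ.source) (hpS : p ∈ totalSet ι ν) {ξ η : Rn n} (hξ : ξ ∈ horizontal k n)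
    (hη : η ∈ vertical k n) :
    ∃ A ∈ subsetTangent (𝓡 n).tangent (totalSet ι ν) p, dnatCoord φ p A = (ξ, η) := by
  -- A straight line in natural coordinates through the given point stays in horizontal × vertical;
  -- its lift to `TM` realizes the prescribed velocity.
  set l : ℝ → Rn n × Rn n := fun t => natCoord φ p + t • (ξ, η) with hl
  have hl0 : l 0 = natCoord φ p := by simp [hl]
  have hlc : ContDiff ℝ ∞ l := by fun_prop
  have hsrc : ∀ᶠ t in 𝓝 (0 : ℝ), (l t).1 ∈ φ.target := by
    have hc : ContinuousAt (fun t => (l t).1) 0 := hlc.continuous.fst.continuousAt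
    refine hc.eventually (φ.open_target.eventually_mem ?_)
    change (l 0).1 ∈ φ.target
    rw [hl0]
    exact φ.map_source hp
  obtain ⟨γ, hγdef⟩ : ∃ γ : ℝ → TangentBundle (𝓡 n) M, γ = natCoordSymm φ ∘ l := ⟨_, rfl⟩
  have hγ0 : γ 0 = p := by
    rw [hγdef, Function.comp, hl0, natCoordSymm_natCoord h.mem_atlas hp]
  have hγ : ContMDiffAt 𝓘(ℝ, ℝ) (𝓡 n).tangent ∞ γ 0 := by
    rw [hγdef]
    refine ContMDiffAt.comp 0 ((contMDiffOn_natCoordSymm h.mem_atlas).contMDiffAt ?_)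
      hlc.contMDiff.contMDiffAt
    exact (φ.open_target.preimage continuous_fst).mem_nhds hsrc.self_of_nhds
  have hnat : ∀ᶠ t in 𝓝 (0 : ℝ), natCoord φ (γ t) = l t := by
    filter_upwards [hsrc] with t ht
    rw [hγdef]
    exact natCoord_natCoordSymm h.mem_atlas ht
  have hmem : ∀ᶠ t in 𝓝 (0 : ℝ), γ t ∈ totalSet ι ν := by
    filter_upwards [hnat, hsrc] with t ht ht'
    have hs : (γ t).1 ∈ φ.source := by rw [hγdef]; exact φ.map_target ht'
    rw [h.mem_totalSet_iff hs, ht]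
    have h0 := (h.mem_totalSet_iff hp).1 hpS
    exact ⟨add_mem h0.1 (Submodule.smul_mem _ _ hξ), add_mem h0.2 (Submodule.smul_mem _ _ hη)⟩
  clear_value l
  subst hγ0
  refine ⟨mfderiv 𝓘(ℝ, ℝ) (𝓡 n).tangent γ 0 (1 : ℝ),
    Submodule.subset_span ⟨γ, hγ, hmem, rfl⟩, ?_⟩
  refine (dnatCoord_mfderiv h.mem_atlas hγ hp).unique ?_
  have h1 : HasDerivAt (fun t : ℝ => natCoord φ (γ 0) + t • (ξ, η)) (ξ, η) 0 := by
    simpa using ((hasDerivAt_id (0 : ℝ)).smul_const (ξ, η)).const_add (natCoord φ (γ 0))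
  refine h1.congr_of_eventuallyEq ?_
  filter_upwards [hnat] with t ht
  rw [Function.comp, ht, hl]

theorem completeLift_eq_zero (h : IsAdaptedChart k ι ν φ) (hσ : IsPresymplectic σ)
    {p : TangentBundle (𝓡 n) M} (hp : p.1 ∈ φ.source) (hpS : p ∈ totalSet ι ν)
    (hflat : FlatAt k (σ.inChart φ) (φ p.1)) {A B : TangentSpace (𝓡 n).tangent p}
    (hA : A ∈ subsetTangent (𝓡 n).tangent (totalSet ι ν) p)
    (hB : B ∈ subsetTangent (𝓡 n).tangent (totalSet ι ν) p) :
    σ.completeLift p ![A, B] = 0 := by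
  rw [completeLift_apply hσ h.mem_atlas hp]
  obtain ⟨hA1, hA2⟩ := h.dnatCoord_mem hp hA
  obtain ⟨hB1, hB2⟩ := h.dnatCoord_mem hp hB
  have hv := ((h.mem_totalSet_iff hp).1 hpS).2
  have e := coordCompleteLift_apply (σ.inChart φ) (natCoord φ p).1 (natCoord φ p).2
    (dnatCoord φ p A).1 (dnatCoord φ p A).2 (dnatCoord φ p B).1 (dnatCoord φ p B).2
  refine e.trans ?_
  have h1 := hflat.2 _ hA1 _ hB1 _ hv
  have h2 := hflat.1 _ hB1 _ hA2
  have h3 := hflat.1 _ hA1 _ hB2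
  rw [← toBilin_apply, toBilin_swap, neg_eq_zero, toBilin_apply] at h2
  change fderiv ℝ (σ.inChart φ) (φ p.1) _ _ + σ.inChart φ (φ p.1) _ + σ.inChart φ (φ p.1) _ = 0
  rw [h1, h2, h3]
  norm_num

theorem flatAt_of_completeLift (h : IsAdaptedChart k ι ν φ) (hσ : IsPresymplectic σ)
    (hiso : IsIsotropic (𝓡 n).tangent (totalSet ι ν) (graphOf σ.completeLift)) {q : N}
    (hq : ι q ∈ φ.source) : FlatAt k (σ.inChart φ) (φ (ι q)) := by
  rw [isIsotropic_graphOf_iff] at hiso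
  have key : ∀ v ∈ vertical k n, ∀ ξ ∈ horizontal k n, ∀ η ∈ vertical k n, ∀ ξ' ∈ horizontal k n,
      ∀ η' ∈ vertical k n, fderiv ℝ (σ.inChart φ) (φ (ι q)) v ![ξ, ξ'] +
        σ.inChart φ (φ (ι q)) ![η, ξ'] + σ.inChart φ (φ (ι q)) ![ξ, η'] = 0 := by
    intro v hv ξ hξ η hη ξ' hξ' η' hη'
    obtain ⟨Z, rfl⟩ := dchart_surjective h.mem_atlas hq v
    have hS : (⟨ι q, Z⟩ : TangentBundle (𝓡 n) M) ∈ totalSet ι ν :=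
      ⟨q, Z, (h.mem_normal_iff hq Z).2 hv, rfl⟩
    obtain ⟨A, hA, hA'⟩ := h.exists_mem_subsetTangent hq hS hξ hη
    obtain ⟨B, hB, hB'⟩ := h.exists_mem_subsetTangent hq hS hξ' hη'
    have h0 := hiso _ hS A hA B hB
    rw [completeLift_apply hσ h.mem_atlas hq, hA', hB', natCoord_mk,
      coordCompleteLift_apply] at h0
    exact h0
  have hz : ∀ (s : Rn n [⋀^Fin 2]→L[ℝ] ℝ) (a : Rn n), s ![a, 0] = 0 ∧ s ![0, a] = 0 := by
    intro s a
    rw [← toBilin_apply, ← toBilin_apply]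
    simp
  refine ⟨fun ξ hξ η hη => ?_, fun ξ hξ ξ' hξ' η hη => ?_⟩
  -- On the zero section the derivative term disappears.
  · have := key 0 (zero_mem _) ξ hξ 0 (zero_mem _) 0 (zero_mem _) η hη
    rwa [(hz _ _).1, (hz _ _).1, zero_add, zero_add] at this
  -- Vectors without fibre component isolate the derivative term at the point `η` of the fibre.
  · have := key η hη ξ hξ 0 (zero_mem _) ξ' hξ' 0 (zero_mem _)
    rwa [(hz _ _).2, (hz _ _).1, add_zero, add_zero] at this

end IsAdaptedChart

end AdaptedChart

/-! ### Vector fields, brackets and the second fundamental form in a chart. -/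

section Fields

variable {n : ℕ} {M : Type*} [TopologicalSpace M] [ChartedSpace (Rn n) M]
  [IsManifold (𝓡 n) ∞ M] {φ ψ : OpenPartialHomeomorph M (Rn n)} {σ : TwoForm (𝓡 n) M}
  {A B Z : (x : M) → TangentSpace (𝓡 n) x} {α β : (x : M) → TangentSpace (𝓡 n) x →L[ℝ] ℝ}
  {U : Set M}

/-- The expression of a vector field in a chart. -/
def fieldInChart (φ : OpenPartialHomeomorph M (Rn n)) (A : (x : M) → TangentSpace (𝓡 n) x)
    (y : Rn n) : Rn n :=
  dchart φ (φ.symm y) (A (φ.symm y))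

theorem contDiffOn_fieldInChart (hφ : φ ∈ IsManifold.maximalAtlas (𝓡 n) ∞ M)
    (hA : SmoothFieldOn A U) :
    ContDiffOn ℝ ∞ (fieldInChart φ A) (φ.target ∩ φ.symm ⁻¹' U) := by
  have h1 := (contMDiffOn_natCoord hφ).comp
    (ContMDiffOn.comp hA ((contMDiffOn_chart_symm hφ).mono
      (inter_subset_left : φ.target ∩ φ.symm ⁻¹' U ⊆ φ.target)) fun y hy => hy.2)
    fun y hy => φ.map_target hy.1
  exact (contMDiffOn_iff_contDiffOn.1 h1).snd

theorem eventually_mem_target_inter (φ : OpenPartialHomeomorph M (Rn n)) (hU : IsOpen U) {y : Rn n}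
    (hy : y ∈ φ.target) (hyU : φ.symm y ∈ U) : φ.target ∩ φ.symm ⁻¹' U ∈ 𝓝 y :=
  inter_mem (φ.open_target.mem_nhds hy) ((φ.continuousAt_symm hy).preimage_mem_nhds
    (hU.mem_nhds hyU))

theorem differentiableAt_fieldInChart (hφ : φ ∈ IsManifold.maximalAtlas (𝓡 n) ∞ M)
    (hA : SmoothFieldOn A U) (hU : IsOpen U) {y : Rn n} (hy : y ∈ φ.target)
    (hyU : φ.symm y ∈ U) : DifferentiableAt ℝ (fieldInChart φ A) y :=
  ((contDiffOn_fieldInChart hφ hA).contDiffAt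
    (eventually_mem_target_inter φ hU hy hyU)).differentiableAt (by simp)

/-- The inverse of the derivative of `φ.symm` is the derivative of `φ`. This connects `fieldInChart`
with naturality of the Lie bracket under pullback. -/
theorem mpullback_chart_symm (hφ : φ ∈ IsManifold.maximalAtlas (𝓡 n) ∞ M)
    (A : (x : M) → TangentSpace (𝓡 n) x) {y : Rn n} (hy : y ∈ φ.target) :
    VectorField.mpullback 𝓘(ℝ, Rn n) (𝓡 n) φ.symm A y = fieldInChart φ A y := by
  rw [VectorField.mpullback_apply]
  have h1 := (mdifferentiable_chart hφ).comp_symm_deriv hy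
  have h2 := (mdifferentiable_chart hφ).symm_comp_deriv (φ.map_target hy)
  rw [φ.right_inv hy] at h2
  exact DFunLike.congr_fun (ContinuousLinearMap.inverse_eq h2 h1) (A (φ.symm y))

theorem mlieBracket_eq_lieBracket {E : Type*} [NormedAddCommGroup E] [NormedSpace ℝ E]
    (V W : (x : E) → TangentSpace 𝓘(ℝ, E) x) (x : E) :
    VectorField.mlieBracket 𝓘(ℝ, E) V W x = VectorField.lieBracket ℝ V W x := by
  have h := VectorField.mlieBracketWithin_eq_lieBracketWithin (V := V) (W := W) (s := univ)
  rw [VectorField.mlieBracketWithin_univ] at h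
  have h' : VectorField.lieBracketWithin ℝ (V : E → E) W univ = VectorField.lieBracket ℝ V W :=
    VectorField.lieBracketWithin_univ
  exact congrFun (h.trans h') x

theorem dchart_mlieBracket (hφ : φ ∈ IsManifold.maximalAtlas (𝓡 n) ∞ M)
    (hA : SmoothFieldOn A U) (hB : SmoothFieldOn B U) (hU : IsOpen U) {y : Rn n}
    (hy : y ∈ φ.target) (hyU : φ.symm y ∈ U) :
    dchart φ (φ.symm y) (VectorField.mlieBracket (𝓡 n) A B (φ.symm y)) =
      VectorField.lieBracket ℝ (fieldInChart φ A) (fieldInChart φ B) y := by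
  have hle : minSmoothness ℝ 2 ≤ ∞ := by
    rw [minSmoothness_of_isRCLikeNormedField]; exact ENat.LEInfty.out
  have : IsManifold (𝓡 n) (minSmoothness ℝ 2) M := IsManifold.of_le hle
  have hA' := (hA.contMDiffAt (hU.mem_nhds hyU)).mdifferentiableAt (by simp)
  have hB' := (hB.contMDiffAt (hU.mem_nhds hyU)).mdifferentiableAt (by simp)
  have h := VectorField.mpullback_mlieBracket hA' hB'
    ((contMDiffOn_chart_symm hφ).contMDiffAt (φ.open_target.mem_nhds hy)) hle
  rw [mpullback_chart_symm hφ _ hy] at h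
  refine h.trans ?_
  have hev : ∀ C : (x : M) → TangentSpace (𝓡 n) x,
      VectorField.mpullback 𝓘(ℝ, Rn n) (𝓡 n) φ.symm C =ᶠ[𝓝 y] fieldInChart φ C := fun C => by
    filter_upwards [φ.open_target.mem_nhds hy] with z hz using mpullback_chart_symm hφ C hz
  rw [(hev A).mlieBracket_vectorField_eq (hev B)]
  exact mlieBracket_eq_lieBracket _ _ y

theorem derivAlong_eq (hφ : φ ∈ IsManifold.maximalAtlas (𝓡 n) ∞ M) {f : M → ℝ} {g : Rn n → ℝ}
    {y : Rn n} (hy : y ∈ φ.target) (hg : DifferentiableAt ℝ g y) (hfg : f ∘ φ.symm =ᶠ[𝓝 y] g)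
    (Z : TangentSpace (𝓡 n) (φ.symm y)) :
    derivAlong f (φ.symm y) Z = fderiv ℝ g y (dchart φ (φ.symm y) Z) := by
  have hx := φ.map_target hy
  have h1 : f =ᶠ[𝓝 (φ.symm y)] g ∘ φ := by
    have hc : Tendsto φ (𝓝 (φ.symm y)) (𝓝 y) := by
      have := φ.continuousAt hx
      rwa [ContinuousAt, φ.right_inv hy] at this
    filter_upwards [hc.eventually hfg, φ.open_source.mem_nhds hx] with z hz hz'
    rw [Function.comp, ← hz, Function.comp, φ.left_inv hz']
  have hg' : MDifferentiableAt 𝓘(ℝ, Rn n) 𝓘(ℝ, ℝ) g (φ (φ.symm y)) := by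
    rw [φ.right_inv hy]; exact hg.mdifferentiableAt
  have h := mfderiv_comp (φ.symm y) hg' ((mdifferentiable_chart hφ).mdifferentiableAt hx)
  rw [← h1.mfderiv_eq, mfderiv_eq_fderiv, φ.right_inv hy] at h
  exact DFunLike.congr_fun h Z

theorem form_eq_inChart (σ : TwoForm (𝓡 n) M) (hφ : φ ∈ IsManifold.maximalAtlas (𝓡 n) ∞ M)
    {y : Rn n} (hy : y ∈ φ.target) (v w : TangentSpace (𝓡 n) (φ.symm y)) :
    σ (φ.symm y) ![v, w] =
      σ.inChart φ y ![dchart φ (φ.symm y) v, dchart φ (φ.symm y) w] := by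
  have h := inChart_dchart σ hφ (φ.map_target hy) v w
  rw [φ.right_inv hy] at h
  exact h.symm

/-- With `α = i(A)σ` and `β = i(B)σ`, the terms containing `DA·Z` and `DB·Z` from the Leibniz rule
cancel those from the brackets. What remains is the Lie derivative of `σ` along `Z`, which involves
only the values of `A` and `B` at the point. -/
theorem secondFundamentalValue_eq (hσ : IsPresymplectic σ)
    (hφ : φ ∈ IsManifold.maximalAtlas (𝓡 n) ∞ M) (hU : IsOpen U)
    (hA : IsSectionOn (graphOf σ) A α U) (hB : IsSectionOn (graphOf σ) B β U)
    (hZ : SmoothFieldOn Z U) {y : Rn n} (hy : y ∈ φ.target) (hyU : φ.symm y ∈ U) :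
    secondFundamentalValue A B Z α β (φ.symm y) =
      fderiv ℝ (σ.inChart φ) y (fieldInChart φ Z y) ![fieldInChart φ A y, fieldInChart φ B y] +
      σ.inChart φ y ![fieldInChart φ A y, fderiv ℝ (fieldInChart φ Z) y (fieldInChart φ B y)] +
      σ.inChart φ y ![fderiv ℝ (fieldInChart φ Z) y (fieldInChart φ A y), fieldInChart φ B y] := by
  have hdA := differentiableAt_fieldInChart hφ hA.smooth_fst hU hy hyU
  have hdB := differentiableAt_fieldInChart hφ hB.smooth_fst hU hy hyU
  have hds := differentiableAt_inChart hσ hφ hy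
  have h1 : derivAlong (fun x => α x (B x)) (φ.symm y) (Z (φ.symm y)) =
      fderiv ℝ (fun z => σ.inChart φ z ![fieldInChart φ A z, fieldInChart φ B z]) y
        (fieldInChart φ Z y) := by
    refine derivAlong_eq hφ hy ?_ ?_ _
    · have : ∀ i : Fin 2, DifferentiableAt ℝ
          (fun z => (![fieldInChart φ A z, fieldInChart φ B z] : Fin 2 → Rn n) i) y := by
        intro i; fin_cases i
        · exact hdA
        · exact hdB
      exact hds.continuousAlternatingMap_apply (g := fun i z =>
        (![fieldInChart φ A z, fieldInChart φ B z] : Fin 2 → Rn n) i) this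
    · filter_upwards [eventually_mem_target_inter φ hU hy hyU] with z hz
      rw [Function.comp, hA.mem _ hz.2 (B (φ.symm z)), form_eq_inChart σ hφ hz.1]
      rfl
  have h2 : α (φ.symm y) (VectorField.mlieBracket (𝓡 n) Z B (φ.symm y)) = σ.inChart φ y
      ![fieldInChart φ A y, VectorField.lieBracket ℝ (fieldInChart φ Z) (fieldInChart φ B) y] := by
    rw [← dchart_mlieBracket hφ hZ hB.smooth_fst hU hy hyU]
    refine (hA.mem _ hyU _).trans ?_
    rw [form_eq_inChart σ hφ hy]
    rfl
  have h3 : β (φ.symm y) (VectorField.mlieBracket (𝓡 n) Z A (φ.symm y)) = σ.inChart φ y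
      ![fieldInChart φ B y, VectorField.lieBracket ℝ (fieldInChart φ Z) (fieldInChart φ A) y] := by
    rw [← dchart_mlieBracket hφ hZ hA.smooth_fst hU hy hyU]
    refine (hB.mem _ hyU _).trans ?_
    rw [form_eq_inChart σ hφ hy]
    rfl
  rw [secondFundamentalValue, h1, h2, h3, fderiv_twoForm_apply hds hdA hdB]
  simp only [VectorField.lieBracket, ← toBilin_apply, map_sub]
  rw [toBilin_swap _ (fderiv ℝ (fieldInChart φ Z) y (fieldInChart φ A y)),
    toBilin_swap _ (fderiv ℝ (fieldInChart φ A) y _)]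
  ring

/-- The vector field which is constant in the chart `φ`. -/
def constField (φ : OpenPartialHomeomorph M (Rn n)) (ξ : Rn n) (x : M) : TangentSpace (𝓡 n) x :=
  (dchart φ x).inverse ξ

theorem dchart_constField (hφ : φ ∈ IsManifold.maximalAtlas (𝓡 n) ∞ M) (ξ : Rn n) {x : M}
    (hx : x ∈ φ.source) : dchart φ x (constField φ ξ x) = ξ := by
  have hinv : (dchart φ x).IsInvertible := ⟨(mdifferentiable_chart hφ).mfderiv hx, rfl⟩
  exact (hinv.inverse_apply_eq.1 rfl).symm

theorem smoothFieldOn_constField (hφ : φ ∈ IsManifold.maximalAtlas (𝓡 n) ∞ M) (ξ : Rn n) :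
    SmoothFieldOn (constField φ ξ) φ.source := by
  have h1 : ContMDiffOn (𝓡 n) 𝓘(ℝ, Rn n × Rn n) ∞ (fun x => (φ x, ξ)) φ.source :=
    ContMDiffOn.prodMk_space (contMDiffOn_chart hφ) contMDiffOn_const
  refine ((contMDiffOn_natCoordSymm hφ).comp h1 fun x hx => φ.map_source hx).congr fun x hx => ?_
  have := natCoordSymm_natCoord hφ (p := ⟨x, constField φ ξ x⟩) hx
  rw [natCoord_mk, dchart_constField hφ ξ hx] at this
  exact this.symm

/-- The contraction of `σ` with `constField φ ξ`, on the domain of the chart `φ`. -/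
def constContraction (σ : TwoForm (𝓡 n) M) (φ : OpenPartialHomeomorph M (Rn n)) (ξ : Rn n) (x : M) :
    TangentSpace (𝓡 n) x →L[ℝ] ℝ :=
  (toBilin (σ.inChart φ (φ x)) ξ) ∘L dchart φ x

theorem constContraction_apply (σ : TwoForm (𝓡 n) M) (φ : OpenPartialHomeomorph M (Rn n)) (ξ : Rn n)
    (x : M) (v : TangentSpace (𝓡 n) x) :
    constContraction σ φ ξ x v = σ.inChart φ (φ x) ![ξ, dchart φ x v] := by
  rw [← toBilin_apply]
  rfl

/-- Smoothness must hold in every chart `ψ`. There, with `τ = φ ∘ ψ.symm`, the form reads `s(τ y)(ξ,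
Dτ(y) ·)`, where `s` is `σ` in `φ`. -/
theorem smoothOneFormOn_constContraction (hσ : IsPresymplectic σ)
    (hφ : φ ∈ IsManifold.maximalAtlas (𝓡 n) ∞ M) (ξ : Rn n) :
    SmoothOneFormOn (constContraction σ φ ξ) φ.source := by
  intro ψ hψ
  have hτ : ContDiffOn ℝ ∞ (φ ∘ ψ.symm) (ψ.target ∩ ψ.symm ⁻¹' φ.source) := fun y hy =>
    (contDiffAt_chartChange hφ hψ hy.1 hy.2).contDiffWithinAt
  have hdτ : ContDiffOn ℝ ∞ (fderiv ℝ (φ ∘ ψ.symm)) (ψ.target ∩ ψ.symm ⁻¹' φ.source) := fun y hy =>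
    ((contDiffAt_chartChange hφ hψ hy.1 hy.2).fderiv_right (m := ∞) (by simp)).contDiffWithinAt
  have hs : ContDiffOn ℝ ∞ (fun y => σ.inChart φ ((φ ∘ ψ.symm) y))
      (ψ.target ∩ ψ.symm ⁻¹' φ.source) :=
    (hσ.smooth φ hφ).comp hτ fun y hy => φ.map_source hy.2
  refine ((contDiffOn_contract hs (contDiffOn_const (c := ξ))).clm_comp hdτ).congr fun y hy => ?_
  ext v
  have h := fderiv_chartChange hφ hψ hy.1 hy.2 v
  rw [ContinuousLinearMap.comp_apply, h]
  rfl

theorem isSectionOn_const (hσ : IsPresymplectic σ) (hφ : φ ∈ IsManifold.maximalAtlas (𝓡 n) ∞ M)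
    (ξ : Rn n) :
    IsSectionOn (graphOf σ) (constField φ ξ) (constContraction σ φ ξ) φ.source where
  smooth_fst := smoothFieldOn_constField hφ ξ
  smooth_snd := smoothOneFormOn_constContraction hσ hφ ξ
  mem x hx v := by
    refine (constContraction_apply σ φ ξ x v).trans ?_
    rw [← inChart_dchart σ hφ hx, dchart_constField hφ ξ hx]

end Fields

/-! ### The totally Dirac condition in an adapted chart. -/

section TotallyDirac

variable {n k : ℕ} {M : Type*} [TopologicalSpace M] [ChartedSpace (Rn n) M]
  [IsManifold (𝓡 n) ∞ M] {N : Type*} [TopologicalSpace N] [ChartedSpace (Rn k) N]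
  {φ : OpenPartialHomeomorph M (Rn n)} {σ : TwoForm (𝓡 n) M} {ι : N → M}
  {ν : (q : N) → Submodule ℝ (TangentSpace (𝓡 n) (ι q))}

namespace IsAdaptedChart

/-- For `T` tangent to `N`, projecting `(T, i(T)σ)` keeps `T` and replaces `i(T)σ` by a covector
vanishing on `ν`. If the projected pair lies in the graph, that covector is again `i(T)σ`, so `σ(T,
Z) = 0` for `Z ∈ ν`. -/
theorem orthogonal_of_properlyNormalized (h : IsAdaptedChart k ι ν φ)
    (hι : ContMDiff (𝓡 k) (𝓡 n) ∞ ι) (hν : IsNormalBundle k ι ν)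
    (hpn : ProperlyNormalized k (graphOf σ) ι ν) {q : N} (hq : ι q ∈ φ.source) {ξ η : Rn n}
    (hξ : ξ ∈ horizontal k n) (hη : η ∈ vertical k n) : σ.inChart φ (φ (ι q)) ![ξ, η] = 0 := by
  obtain ⟨T, rfl⟩ := dchart_surjective h.mem_atlas hq ξ
  obtain ⟨Z, rfl⟩ := dchart_surjective h.mem_atlas hq η
  have hT := (h.mem_tangentSub_iff hι hν hq T).2 hξ
  have hZ := (h.mem_normal_iff hq Z).2 hη
  have hmem := hpn q T (constContraction σ φ (dchart φ (ι q) T) (ι q))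
    (fun C => by
      refine (constContraction_apply _ _ _ _ _).trans ?_
      rw [inChart_dchart σ h.mem_atlas hq])
    T hT (by rw [sub_self]; exact zero_mem _)
    -- `pr_{T*N}` of the contraction: precomposition with the horizontal projection of the chart.
    ((toBilin (σ.inChart φ (φ (ι q))) (dchart φ (ι q) T)) ∘L horizontalProj k n ∘L dchart φ (ι q))
    (fun Y hY => by
      have hY' := (h.mem_tangentSub_iff hι hν hq Y).1 hY
      rw [constContraction_apply, ← toBilin_apply, ContinuousLinearMap.comp_apply,
        ContinuousLinearMap.comp_apply, horizontalProj_of_mem hY'])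
    (fun Y hY => by
      have hY' := (h.mem_normal_iff hq Y).1 hY
      rw [ContinuousLinearMap.comp_apply, ContinuousLinearMap.comp_apply,
        horizontalProj_of_mem_vertical hY', map_zero]) Z
  rw [inChart_dchart σ h.mem_atlas hq]
  refine hmem.symm.trans ?_
  rw [ContinuousLinearMap.comp_apply, ContinuousLinearMap.comp_apply,
    horizontalProj_of_mem_vertical hη, map_zero]

theorem flatAt_of_isTotallyDiracWith (h : IsAdaptedChart k ι ν φ) (hσ : IsPresymplectic σ)
    (hι : ContMDiff (𝓡 k) (𝓡 n) ∞ ι) (hν : IsNormalBundle k ι ν)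
    (hD : IsTotallyDiracWith k (graphOf σ) ι ν) {q : N} (hq : ι q ∈ φ.source) :
    FlatAt k (σ.inChart φ) (φ (ι q)) := by
  have horth : ∀ q, ι q ∈ φ.source → ∀ ξ ∈ horizontal k n, ∀ η ∈ vertical k n,
      σ.inChart φ (φ (ι q)) ![ξ, η] = 0 := fun q hq ξ hξ η hη =>
    h.orthogonal_of_properlyNormalized hι hν hD.1 hq hξ hη
  refine ⟨horth q hq, fun ξ hξ ξ' hξ' η hη => ?_⟩
  -- Orthogonality along all of `N` in the chart is what makes the contraction with a constant
  -- horizontal field annihilate `ν`.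
  have hsec : ∀ ξ ∈ horizontal k n, IsTangentialSectionOn k (graphOf σ) ι ν (constField φ ξ)
      (constContraction σ φ ξ) φ.source := fun ξ hξ =>
    { isSection := isSectionOn_const hσ h.mem_atlas ξ
      tangent := fun q hq => by
        rw [h.mem_tangentSub_iff hι hν hq, dchart_constField h.mem_atlas ξ hq]
        exact hξ
      cotangent := fun q hq Z hZ => by
        rw [constContraction_apply]
        exact horth q hq ξ hξ _ ((h.mem_normal_iff hq Z).1 hZ) }
  have h0 := hD.2 q φ.source φ.open_source hq _ _ (constField φ η) _ _ (hsec ξ hξ) (hsec ξ' hξ')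
    (smoothFieldOn_constField h.mem_atlas η) (fun q' hq' => by
      rw [h.mem_normal_iff hq', dchart_constField h.mem_atlas η hq']
      exact hη)
  obtain ⟨y, hy, hyq⟩ : ∃ y ∈ φ.target, φ.symm y = ι q := ⟨φ (ι q), φ.map_source hq, φ.left_inv hq⟩
  have hyq' : φ (ι q) = y := by rw [← hyq, φ.right_inv hy]
  rw [← hyq, secondFundamentalValue_eq hσ h.mem_atlas φ.open_source (hsec ξ hξ).isSection
    (hsec ξ' hξ').isSection (smoothFieldOn_constField h.mem_atlas η) hy (φ.map_target hy)] at h0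
  have hc : ∀ ζ : Rn n, ∀ z ∈ φ.target, fieldInChart φ (constField φ ζ) z = ζ := fun ζ z hz =>
    dchart_constField h.mem_atlas ζ (φ.map_target hz)
  -- The field `Z` is constant in the chart, so of the Lie derivative only `(∂_η s)(ξ, ξ')`
  -- survives.
  have hd : fderiv ℝ (fieldInChart φ (constField φ η)) y = 0 := by
    have he : fieldInChart φ (constField φ η) =ᶠ[𝓝 y] fun _ => η := by
      filter_upwards [φ.open_target.mem_nhds hy] with z hz using hc η z hz
    rw [he.fderiv_eq, fderiv_const_apply]
  rw [hc _ _ hy, hc _ _ hy, hc _ _ hy, hd] at h0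
  simp only [_root_.zero_apply, ← toBilin_apply, map_zero, add_zero] at h0
  rw [hyq', ← toBilin_apply]
  exact h0

/-- Write `C = C₁ + C₂` along `ν ⊕ TN`. Then `τ(C) = α(C₂) = σ(A, C₂)`. Since `A - T` and `C₁` lie
in `ν`, orthogonality to `TN` turns this into `σ(T, C₂) = σ(T, C)`. -/
theorem graph_projection_mem (h : IsAdaptedChart k ι ν φ) (hι : ContMDiff (𝓡 k) (𝓡 n) ∞ ι)
    (hν : IsNormalBundle k ι ν) {q : N} (hq : ι q ∈ φ.source)
    (hflat : FlatAt k (σ.inChart φ) (φ (ι q))) {A T : TangentSpace (𝓡 n) (ι q)}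
    {α τ : TangentSpace (𝓡 n) (ι q) →L[ℝ] ℝ} (hA : (A, α) ∈ graphOf σ (ι q))
    (hT : T ∈ tangentSub k ι q) (hAT : A - T ∈ ν q) (hτT : ∀ Y ∈ tangentSub k ι q, τ Y = α Y)
    (hτν : ∀ Z ∈ ν q, τ Z = 0) : (T, τ) ∈ graphOf σ (ι q) := by
  intro C
  have hsup : C ∈ ν q ⊔ tangentSub k ι q := by rw [(hν.isCompl q).sup_eq_top]; trivial
  obtain ⟨C₁, hC₁, C₂, hC₂, rfl⟩ := Submodule.mem_sup.1 hsup
  have hT' := (h.mem_tangentSub_iff hι hν hq T).1 hT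
  have hC₁' := (h.mem_normal_iff hq C₁).1 hC₁
  have hC₂' := (h.mem_tangentSub_iff hι hν hq C₂).1 hC₂
  have hAT' := (h.mem_normal_iff hq _).1 hAT
  have h1 : τ (C₁ + C₂) = σ (ι q) ![A, C₂] := by
    rw [map_add, hτν C₁ hC₁, hτT C₂ hC₂, zero_add]
    exact hA C₂
  refine h1.trans ?_
  rw [← inChart_dchart σ h.mem_atlas hq, ← inChart_dchart σ h.mem_atlas hq]
  have e1 := hflat.1 _ hT' _ hC₁'
  have e2 := hflat.1 _ hC₂' _ hAT'
  rw [map_sub] at e2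
  rw [← toBilin_apply] at e1 e2 ⊢
  rw [← toBilin_apply]
  rw [toBilin_swap, map_sub, _root_.sub_apply] at e2
  rw [map_add, map_add, e1, zero_add]
  linarith

theorem secondFundamentalValue_eq_zero (h : IsAdaptedChart k ι ν φ) (hσ : IsPresymplectic σ)
    (hι : ContMDiff (𝓡 k) (𝓡 n) ∞ ι) (hν : IsNormalBundle k ι ν) {q : N} (hq : ι q ∈ φ.source)
    (hflat : FlatAt k (σ.inChart φ) (φ (ι q))) {U : Set M} (hU : IsOpen U) (hqU : ι q ∈ U)
    {A B Z : (x : M) → TangentSpace (𝓡 n) x} {α β : (x : M) → TangentSpace (𝓡 n) x →L[ℝ] ℝ}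
    (hA : IsTangentialSectionOn k (graphOf σ) ι ν A α U)
    (hB : IsTangentialSectionOn k (graphOf σ) ι ν B β U) (hZ : SmoothFieldOn Z U)
    (hZν : ∀ q', ι q' ∈ U → Z (ι q') ∈ ν q') :
    secondFundamentalValue A B Z α β (ι q) = 0 := by
  obtain ⟨y, hy, hyq⟩ : ∃ y ∈ φ.target, φ.symm y = ι q := ⟨φ (ι q), φ.map_source hq, φ.left_inv hq⟩
  have hyq' : φ (ι q) = y := by rw [← hyq, φ.right_inv hy]
  have hyU : φ.symm y ∈ U := by rwa [hyq]
  have ha : fieldInChart φ A y ∈ horizontal k n := by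
    rw [fieldInChart, hyq]
    exact (h.mem_tangentSub_iff hι hν hq _).1 (hA.tangent q hqU)
  have hb : fieldInChart φ B y ∈ horizontal k n := by
    rw [fieldInChart, hyq]
    exact (h.mem_tangentSub_iff hι hν hq _).1 (hB.tangent q hqU)
  have hvert : ∀ z ∈ φ.target ∩ φ.symm ⁻¹' U, z ∈ horizontal k n →
      fieldInChart φ Z z ∈ vertical k n := by
    intro z hz hzh
    have hzs := φ.map_target hz.1
    obtain ⟨q', hq'⟩ := (h.mem_range_iff hzs).2 (by rwa [φ.right_inv hz.1])
    have hzU : φ.symm z ∈ U := hz.2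
    rw [fieldInChart]
    rw [← hq'] at hzs hzU ⊢
    exact (h.mem_normal_iff hzs _).1 (hZν q' hzU)
  have hyh : y ∈ horizontal k n := by
    rw [← hyq']
    exact (h.mem_range_iff hq).1 (mem_range_self q)
  -- For horizontal `ξ` the line `y + tξ` stays in `N` for small `t`, and there the first `k`
  -- components of `Z` vanish.
  have hdz : ∀ ξ ∈ horizontal k n, fderiv ℝ (fieldInChart φ Z) y ξ ∈ vertical k n := by
    intro ξ hξ i hi
    have hline : HasDerivAt (fun t : ℝ => y + t • ξ) ξ 0 := by
      simpa using ((hasDerivAt_id (0 : ℝ)).smul_const ξ).const_add y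
    have hZd : HasFDerivAt (fieldInChart φ Z) (fderiv ℝ (fieldInChart φ Z) y)
        ((fun t : ℝ => y + t • ξ) 0) := by
      simpa using (differentiableAt_fieldInChart h.mem_atlas hZ hU hy hyU).hasFDerivAt
    refine clm_apply_deriv_eq_zero (hZd.comp_hasDerivAt 0 hline) (coordProj i) ?_
    have hcont : Tendsto (fun t : ℝ => y + t • ξ) (𝓝 0) (𝓝 y) := by
      have := hline.continuousAt
      simpa [ContinuousAt] using this
    filter_upwards [hcont (eventually_mem_target_inter φ hU hy hyU)] with t ht
    exact hvert _ ht (add_mem hyh (Submodule.smul_mem _ _ hξ)) i hi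
  rw [hyq'] at hflat
  rw [← hyq, secondFundamentalValue_eq hσ h.mem_atlas hU hA.isSection hB.isSection hZ hy hyU]
  have e1 := hflat.2 _ ha _ hb _ (hvert y ⟨hy, hyU⟩ hyh)
  have e2 := hflat.1 _ ha _ (hdz _ hb)
  have e3 := hflat.1 _ hb _ (hdz _ ha)
  rw [← toBilin_apply, toBilin_swap, neg_eq_zero, toBilin_apply] at e3
  rw [e1, e2, e3]
  norm_num

end IsAdaptedChart

end TotallyDirac

/-! ### The inverse function theorem on an open set. -/

theorem exists_local_diffeomorph {n : ℕ} {f : Rn n → Rn n} {S : Set (Rn n)} (hS : IsOpen S)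
    (hf : ContDiffOn ℝ ∞ f S) {z : Rn n} (hz : z ∈ S)
    (hsurj : Function.Surjective (fderiv ℝ f z)) :
    ∃ e : OpenPartialHomeomorph (Rn n) (Rn n), z ∈ e.source ∧ e.source ⊆ S ∧ (e : Rn n → Rn n) = f ∧
      ContDiffOn ℝ ∞ e.symm e.target ∧
      ∀ w ∈ e.source, Function.Injective (fderiv ℝ f w) := by
  have hbij : Function.Bijective (fderiv ℝ f z) :=
    ⟨(LinearMap.injective_iff_surjective (f := (fderiv ℝ f z).toLinearMap)).2 hsurj, hsurj⟩
  set f' : Rn n ≃L[ℝ] Rn n :=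
    (LinearEquiv.ofBijective (fderiv ℝ f z).toLinearMap hbij).toContinuousLinearEquiv with hf'
  have hfz : ContDiffAt ℝ ∞ f z := hf.contDiffAt (hS.mem_nhds hz)
  have hfe : (f' : Rn n →L[ℝ] Rn n) = fderiv ℝ f z := by ext v; rfl
  have hfd : HasFDerivAt f (f' : Rn n →L[ℝ] Rn n) z := by
    rw [hfe]; exact (hfz.differentiableAt (by simp)).hasFDerivAt
  set e₀ := hfz.toOpenPartialHomeomorph f hfd (by simp) with he₀
  have hcoe : (e₀ : Rn n → Rn n) = f := hfz.toOpenPartialHomeomorph_coe hfd (by simp)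
  have hcont : ContinuousOn (fderiv ℝ f) S := hf.continuousOn_fderiv_of_isOpen hS (by simp)
  -- Restricting to points with invertible derivative makes the inverse smooth on the whole target,
  -- not just near the image of `z`. This set is open because the invertible maps are open and the
  -- derivative is continuous on `S`.
  set R : Set (Rn n) := S ∩ fderiv ℝ f ⁻¹' range ((↑) : (Rn n ≃L[ℝ] Rn n) → Rn n →L[ℝ] Rn n) with hR
  have hRo : IsOpen R := hcont.isOpen_inter_preimage hS ContinuousLinearEquiv.isOpen
  refine ⟨e₀.restrOpen R hRo, ⟨hfz.mem_toOpenPartialHomeomorph_source hfd (by simp), hz, f', hfe⟩,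
    fun w hw => hw.2.1, hcoe, ?_, ?_⟩
  · intro y hy
    have hy' := (e₀.restrOpen R hRo).map_target hy
    obtain ⟨⟨-, hyS, g, hg⟩⟩ : (e₀.restrOpen R hRo).symm y ∈ e₀.source ∩ R ∧ True := ⟨hy', trivial⟩
    have hc : ContDiffAt ℝ ∞ f ((e₀.restrOpen R hRo).symm y) := hf.contDiffAt (hS.mem_nhds hyS)
    refine ((e₀.restrOpen R hRo).contDiffAt_symm (f₀' := g) hy ?_ ?_).contDiffWithinAt
    · change HasFDerivAt (e₀ : Rn n → Rn n) _ _
      rw [hcoe, hg]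
      exact (hc.differentiableAt (by simp)).hasFDerivAt
    · change ContDiffAt ℝ ∞ (e₀ : Rn n → Rn n) _
      rw [hcoe]
      exact hc
  · intro w hw
    obtain ⟨g, hg⟩ := hw.2.2
    rw [← hg]
    exact g.injective

/-! ### Splitting `ℝⁿ` into `k` and `n - k` coordinates; the ruled map. -/

section Splitting

variable {n k : ℕ}

/-- The first `k` coordinates of a point of `ℝⁿ`. -/
def firstCoords (hk : k ≤ n) : Rn n →L[ℝ] Rn k :=
  LinearMap.toContinuousLinearMap
    { toFun := fun z => WithLp.toLp 2 fun i => z (Fin.castLE hk i)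
      map_add' := by intro a b; ext i; simp
      map_smul' := by intro c a; ext i; simp }

/-- The inclusion of `ℝᵏ` in `ℝⁿ` as the span of the first `k` coordinate directions. -/
def horizontalIncl (k n : ℕ) : Rn k →L[ℝ] Rn n :=
  LinearMap.toContinuousLinearMap
    { toFun := fun u => WithLp.toLp 2 fun i => if h : (i : ℕ) < k then u ⟨i, h⟩ else 0
      map_add' := by intro a b; ext i; by_cases h : (i : ℕ) < k <;> simp [h]
      map_smul' := by intro c a; ext i; by_cases h : (i : ℕ) < k <;> simp [h] }

/-- The point of `ℝⁿ` with the given last `n - k` coordinates, and first `k` coordinates `0`. -/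
def verticalIncl (c : Fin (n - k) → ℝ) : Rn n :=
  WithLp.toLp 2 fun i => if h : k ≤ (i : ℕ) then c ⟨i - k, by omega⟩ else 0

/-- The position of the `a`-th of the last `n - k` coordinates. -/
def lastIdx (a : Fin (n - k)) : Fin n := ⟨k + a, by omega⟩

theorem firstCoords_apply (hk : k ≤ n) (z : Rn n) (i : Fin k) :
    firstCoords hk z i = z (Fin.castLE hk i) := rfl

theorem horizontalIncl_apply (u : Rn k) (i : Fin n) :
    horizontalIncl k n u i = if h : (i : ℕ) < k then u ⟨i, h⟩ else 0 := rfl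

theorem verticalIncl_apply (c : Fin (n - k) → ℝ) (i : Fin n) :
    verticalIncl c i = if h : k ≤ (i : ℕ) then c ⟨i - k, by omega⟩ else 0 := rfl

theorem firstCoords_horizontalIncl (hk : k ≤ n) (u : Rn k) :
    firstCoords hk (horizontalIncl k n u) = u := by
  ext i
  rw [firstCoords_apply, horizontalIncl_apply, dif_pos (by simp)]
  rfl

theorem horizontalIncl_mem (u : Rn k) : horizontalIncl k n u ∈ horizontal k n := by
  intro i hi
  rw [horizontalIncl_apply, dif_neg (by omega)]

theorem horizontalIncl_firstCoords (hk : k ≤ n) {z : Rn n} (hz : z ∈ horizontal k n) :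
    horizontalIncl k n (firstCoords hk z) = z := by
  ext i
  rw [horizontalIncl_apply]
  split_ifs with h
  · rfl
  · exact (hz i (by omega)).symm

theorem verticalIncl_mem (c : Fin (n - k) → ℝ) : verticalIncl c ∈ vertical k n := by
  intro i hi
  rw [verticalIncl_apply, dif_neg (by omega)]

theorem verticalIncl_lastIdx (c : Fin (n - k) → ℝ) (a : Fin (n - k)) :
    verticalIncl c (lastIdx a) = c a := by
  rw [verticalIncl_apply, dif_pos (by simp [lastIdx])]
  congr 1
  ext
  simp [lastIdx]

theorem horizontal_lastIdx {z : Rn n} (hz : z ∈ horizontal k n) (a : Fin (n - k)) :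
    z (lastIdx a) = 0 :=
  hz _ (by simp [lastIdx])

theorem firstCoords_of_vertical (hk : k ≤ n) {z : Rn n} (hz : z ∈ vertical k n) :
    firstCoords hk z = 0 := by
  ext i
  exact hz _ i.2

/-- The map `(x, y) ↦ g(x) + ∑ yᵃ Wₐ(x)`. -/
def ruledMap (hk : k ≤ n) (g : Rn k → Rn n) (W : Fin (n - k) → Rn k → Rn n) (z : Rn n) : Rn n :=
  g (firstCoords hk z) + ∑ a, z (lastIdx a) • W a (firstCoords hk z)

theorem ruledMap_horizontalIncl (hk : k ≤ n) (g : Rn k → Rn n) (W : Fin (n - k) → Rn k → Rn n)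
    (u : Rn k) : ruledMap hk g W (horizontalIncl k n u) = g u := by
  simp [ruledMap, firstCoords_horizontalIncl, horizontal_lastIdx (horizontalIncl_mem u)]

theorem contDiffOn_ruledMap (hk : k ≤ n) {g : Rn k → Rn n} {W : Fin (n - k) → Rn k → Rn n}
    {D : Set (Rn k)} (hg : ContDiffOn ℝ ∞ g D) (hW : ∀ a, ContDiffOn ℝ ∞ (W a) D) :
    ContDiffOn ℝ ∞ (ruledMap hk g W) (firstCoords hk ⁻¹' D) := by
  have hP : ContDiffOn ℝ ∞ (firstCoords hk) (firstCoords hk ⁻¹' D) :=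
    (firstCoords hk).contDiff.contDiffOn
  refine (hg.comp hP fun z hz => hz).add (ContDiffOn.sum fun a _ => ?_)
  exact (coordProj (lastIdx a)).contDiff.contDiffOn.smul ((hW a).comp hP fun z hz => hz)

/-- At `y = 0` the derivatives of the `W a` are multiplied by `yᵃ = 0` and drop out. Thus horizontal
directions map through `Dg`, and vertical ones onto the span of the `W a`. -/
theorem fderiv_ruledMap (hk : k ≤ n) {g : Rn k → Rn n} {W : Fin (n - k) → Rn k → Rn n} {u : Rn k}
    (hg : DifferentiableAt ℝ g u) (hW : ∀ a, DifferentiableAt ℝ (W a) u) (ζ : Rn n) :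
    fderiv ℝ (ruledMap hk g W) (horizontalIncl k n u) ζ =
      fderiv ℝ g u (firstCoords hk ζ) + ∑ a, ζ (lastIdx a) • W a u := by
  have hu := firstCoords_horizontalIncl hk u
  have hP : HasFDerivAt (firstCoords hk) (firstCoords hk) (horizontalIncl k n u) :=
    (firstCoords hk).hasFDerivAt
  have h1 : HasFDerivAt (fun z => g (firstCoords hk z)) (fderiv ℝ g u ∘L firstCoords hk)
      (horizontalIncl k n u) :=
    HasFDerivAt.comp _ (by rw [hu]; exact hg.hasFDerivAt) hP
  have h2 : ∀ a, HasFDerivAt (fun z : Rn n => z (lastIdx a) • W a (firstCoords hk z))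
      ((coordProj (lastIdx a)).smulRight (W a u)) (horizontalIncl k n u) := by
    intro a
    have h3 : HasFDerivAt (fun z => W a (firstCoords hk z)) (fderiv ℝ (W a) u ∘L firstCoords hk)
        (horizontalIncl k n u) :=
      HasFDerivAt.comp _ (by rw [hu]; exact (hW a).hasFDerivAt) hP
    have h4 := (coordProj (lastIdx a)).hasFDerivAt (x := horizontalIncl k n u) |>.smul h3
    have h5 : coordProj (lastIdx a) (horizontalIncl k n u) = 0 :=
      horizontal_lastIdx (horizontalIncl_mem u) a
    rw [h5, zero_smul, zero_add, hu] at h4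
    exact h4
  have h6 : HasFDerivAt (ruledMap hk g W) _ (horizontalIncl k n u) :=
    h1.add (HasFDerivAt.fun_sum fun a _ => h2 a)
  rw [h6.fderiv]
  simp [coordProj]

end Splitting

/-! ### Existence of adapted charts. -/

section Existence

variable {n k : ℕ} {M : Type*} [TopologicalSpace M] [ChartedSpace (Rn n) M]
  [IsManifold (𝓡 n) ∞ M] {N : Type*} [TopologicalSpace N] [ChartedSpace (Rn k) N]
  [IsManifold (𝓡 k) ∞ N] {ι : N → M}
  {ν : (q : N) → Submodule ℝ (TangentSpace (𝓡 n) (ι q))}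

theorem le_of_isImmersionAt {q : N} (h : Manifold.IsImmersionAt (𝓡 k) (𝓡 n) ∞ ι q) : k ≤ n := by
  have hinj : Function.Injective (h.equiv.toLinearMap ∘ₗ LinearMap.inl ℝ (Rn k) h.complement) :=
    h.equiv.injective.comp LinearMap.inl_injective
  have := LinearMap.finrank_le_finrank_of_injective hinj
  simpa using this

/-- In a chart `c` of `M`, let `g` parametrize `N` and let `W` represent a local frame of `ν`. The
ruled map `g(x) + ∑ yᵃ Wₐ(x)` has invertible derivative at the point of `q₀` because `T_N M = ν ⊕
TN`. Its local inverse composed with `c` flattens `N` and sends `ν` to the vertical directions at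
every point of `N` in the domain. -/
theorem exists_adaptedChart (hι : Manifold.IsSmoothEmbedding (𝓡 k) (𝓡 n) ∞ ι)
    (hν : IsNormalBundle k ι ν) (q₀ : N) :
    ∃ φ : OpenPartialHomeomorph M (Rn n), ι q₀ ∈ φ.source ∧ IsAdaptedChart k ι ν φ := by
  have hk : k ≤ n := le_of_isImmersionAt (hι.isImmersion.isImmersionAt q₀)
  have hιs : ContMDiff (𝓡 k) (𝓡 n) ∞ ι := hι.contMDiff
  obtain ⟨U, hU, hq₀U, V, hV, hVν⟩ := hν.smooth q₀
  set c := chartAt (Rn n) (ι q₀)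
  have hc : c ∈ IsManifold.maximalAtlas (𝓡 n) ∞ M := IsManifold.chart_mem_maximalAtlas _
  have hc₀ : ι q₀ ∈ c.source := mem_chart_source _ _
  set d := chartAt (Rn k) q₀
  have hd : d ∈ IsManifold.maximalAtlas (𝓡 k) ∞ N := IsManifold.chart_mem_maximalAtlas _
  have hd₀ : q₀ ∈ d.source := mem_chart_source _ _
  set D : Set (Rn k) := d.target ∩ d.symm ⁻¹' (U ∩ ι ⁻¹' c.source) with hD
  have hDo : IsOpen D :=
    d.isOpen_inter_preimage_symm (hU.inter (c.open_source.preimage hιs.continuous))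
  have hu₀ : d q₀ ∈ D := ⟨d.map_source hd₀, by
    rw [mem_preimage, d.left_inv hd₀]; exact ⟨hq₀U, hc₀⟩⟩
  obtain ⟨g, hg⟩ : ∃ g : Rn k → Rn n, g = fun u => c (ι (d.symm u)) := ⟨_, rfl⟩
  obtain ⟨W, hW⟩ : ∃ W : Fin (n - k) → Rn k → Rn n,
      W = fun a u => dchart c (ι (d.symm u)) (V a (d.symm u)) := ⟨_, rfl⟩
  have hds : ContMDiffOn 𝓘(ℝ, Rn k) (𝓡 k) ∞ d.symm D :=
    (contMDiffOn_chart_symm hd).mono inter_subset_left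
  have hgs : ContDiffOn ℝ ∞ g D := by
    rw [hg]
    exact contMDiffOn_iff_contDiffOn.1 ((contMDiffOn_chart hc).comp
      (hιs.comp_contMDiffOn hds) fun u hu => hu.2.2)
  have hWs : ∀ a, ContDiffOn ℝ ∞ (W a) D := by
    intro a
    rw [hW]
    have h1 := (contMDiffOn_natCoord hc).comp ((hV a).comp hds fun u hu => hu.2.1)
      fun u hu => hu.2.2
    exact (contMDiffOn_iff_contDiffOn.1 h1).snd
  have hgd : ∀ u ∈ D, DifferentiableAt ℝ g u := fun u hu =>
    (hgs.contDiffAt (hDo.mem_nhds hu)).differentiableAt (by simp)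
  have hWd : ∀ u ∈ D, ∀ a, DifferentiableAt ℝ (W a) u := fun u hu a =>
    ((hWs a).contDiffAt (hDo.mem_nhds hu)).differentiableAt (by simp)
  have hvert : ∀ u ∈ D, ∀ η ∈ vertical k n, fderiv ℝ (ruledMap hk g W) (horizontalIncl k n u) η =
      dchart c (ι (d.symm u)) (∑ a, η (lastIdx a) • V a (d.symm u)) := by
    intro u hu η hη
    rw [fderiv_ruledMap hk (hgd u hu) (hWd u hu), firstCoords_of_vertical hk hη, map_zero, zero_add,
      map_sum]
    refine Finset.sum_congr rfl fun a _ => ?_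
    rw [map_smul, hW]
  have hsurj : Function.Surjective (fderiv ℝ (ruledMap hk g W) (horizontalIncl k n (d q₀))) := by
    intro t
    obtain ⟨q, hq, hqU⟩ : ∃ q, q = d.symm (d q₀) ∧ q ∈ U :=
      ⟨_, rfl, hu₀.2.1⟩
    obtain ⟨Z, rfl⟩ := dchart_surjective hc (x := ι q) (by rw [hq]; exact hu₀.2.2) t
    have hsup : Z ∈ ν q ⊔ tangentSub k ι q := by rw [(hν.isCompl q).sup_eq_top]; trivial
    obtain ⟨Z₁, hZ₁, Z₂, hZ₂, rfl⟩ := Submodule.mem_sup.1 hsup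
    rw [hVν q hqU, Submodule.mem_span_range_iff_exists_fun] at hZ₁
    obtain ⟨b, rfl⟩ := hZ₁
    obtain ⟨w, rfl⟩ := hZ₂
    subst hq
    -- The vertical part carries the frame coefficients of the `ν`-component; the horizontal part is
    -- the tangent vector of `N` read in the chart `d`.
    refine ⟨verticalIncl b + horizontalIncl k n (dchart d (d.symm (d q₀)) w), ?_⟩
    rw [map_add, hvert _ hu₀ _ (verticalIncl_mem b), map_add]
    congr 1
    · simp only [verticalIncl_lastIdx]
    · rw [fderiv_ruledMap hk (hgd _ hu₀) (hWd _ hu₀), firstCoords_horizontalIncl]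
      simp only [horizontal_lastIdx (horizontalIncl_mem _), zero_smul, Finset.sum_const_zero,
        add_zero]
      have hdu : d.symm (d q₀) ∈ d.source := d.map_target hu₀.1
      have e1 : g ∘ d =ᶠ[𝓝 (d.symm (d q₀))] c ∘ ι := by
        filter_upwards [d.open_source.mem_nhds hdu] with q hq
        simp [hg, d.left_inv hq]
      have e2 := mfderiv_comp (d.symm (d q₀)) (I' := 𝓘(ℝ, Rn k))
        (I'' := 𝓘(ℝ, Rn n)) (g := g) (f := d)
        (by rw [d.right_inv hu₀.1]; exact (hgd _ hu₀).mdifferentiableAt)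
        ((mdifferentiable_chart hd).mdifferentiableAt hdu)
      have e3 := mfderiv_comp (d.symm (d q₀)) ((mdifferentiable_chart hc).mdifferentiableAt hu₀.2.2)
        ((hιs _).mdifferentiableAt (by simp))
      rw [e1.mfderiv_eq, e3, d.right_inv hu₀.1, mfderiv_eq_fderiv] at e2
      exact (DFunLike.congr_fun e2 w).symm
  obtain ⟨e, he₀, heD, hecoe, hesymm, heinj⟩ := exists_local_diffeomorph
    (hDo.preimage (firstCoords hk).continuous) (contDiffOn_ruledMap hk hgs hWs)
    (by rw [mem_preimage, firstCoords_horizontalIncl]; exact hu₀) hsurj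
  have hes : ContDiffOn ℝ ∞ e e.source := by
    rw [hecoe]; exact (contDiffOn_ruledMap hk hgs hWs).mono heD
  have hQ : IsOpen (d.source ∩ d ⁻¹' (D ∩ horizontalIncl k n ⁻¹' e.source)) :=
    d.isOpen_inter_preimage (hDo.inter (e.open_source.preimage (horizontalIncl k n).continuous))
  -- Here `ι` has to be an embedding: shrinking to `O` excludes points of `N` that come close in `M`
  -- while lying outside the parametrized piece.
  obtain ⟨O, hO, hOQ⟩ := hι.isEmbedding.isInducing.isOpen_iff.1 hQ
  set φ : OpenPartialHomeomorph M (Rn n) := (c.trans e.symm).restrOpen O hO with hφ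
  have hφsrc : ∀ x, x ∈ φ.source → x ∈ c.source ∧ c x ∈ e.target ∧ x ∈ O := by
    intro x hx
    have : x ∈ (c.source ∩ c ⁻¹' e.symm.source) ∩ O := by simpa [hφ] using hx
    exact ⟨this.1.1, this.1.2, this.2⟩
  have hφapp : ∀ x, φ x = e.symm (c x) := fun x => rfl
  have hφmem : φ ∈ IsManifold.maximalAtlas (𝓡 n) ∞ M := by
    refine φ.mem_maximalAtlas_of_contMDiffOn ?_ ?_
    · exact (contMDiffOn_iff_contDiffOn.2 hesymm).comp
        ((contMDiffOn_chart hc).mono fun x hx => (hφsrc x hx).1) fun x hx => (hφsrc x hx).2.1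
    · have ht : ∀ z ∈ φ.target, z ∈ e.source ∧ e z ∈ c.target := by
        intro z hz
        have : z ∈ (c.trans e.symm).target := by
          have := φ.map_target hz
          have h2 : z = φ (φ.symm z) := (φ.right_inv hz).symm
          rw [h2]
          refine (c.trans e.symm).map_source ?_
          have h3 : φ.symm z ∈ (c.trans e.symm).source ∩ O := by simpa [hφ] using this
          exact h3.1
        simpa using this
      exact (contMDiffOn_chart_symm hc).comp
        ((contMDiffOn_iff_contDiffOn.2 hes).mono fun z hz => (ht z hz).1) fun z hz => (ht z hz).2
  have hpt : ∀ q, ι q ∈ O → ∃ u ∈ D, d.symm u = q ∧ horizontalIncl k n u ∈ e.source ∧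
      e.symm (c (ι q)) = horizontalIncl k n u := by
    intro q hq
    have hqQ : q ∈ d.source ∩ d ⁻¹' (D ∩ horizontalIncl k n ⁻¹' e.source) := by
      rw [← hOQ]; exact hq
    refine ⟨d q, hqQ.2.1, d.left_inv hqQ.1, hqQ.2.2, ?_⟩
    have h1 : e (horizontalIncl k n (d q)) = c (ι q) := by
      rw [hecoe, ruledMap_horizontalIncl, hg]
      simp only [d.left_inv hqQ.1]
    rw [← h1, e.left_inv hqQ.2.2]
  refine ⟨φ, ?_, hφmem, ?_, ?_⟩
  · have h1 : ι q₀ ∈ O := by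
      change q₀ ∈ ι ⁻¹' O
      rw [hOQ]
      exact ⟨hd₀, hu₀, he₀⟩
    have h2 : c (ι q₀) ∈ e.target := by
      have : e (horizontalIncl k n (d q₀)) = c (ι q₀) := by
        rw [hecoe, ruledMap_horizontalIncl, hg]
        simp only [d.left_inv hd₀]
      rw [← this]
      exact e.map_source he₀
    have : ι q₀ ∈ (c.source ∩ c ⁻¹' e.symm.source) ∩ O := ⟨⟨hc₀, h2⟩, h1⟩
    simpa [hφ] using this
  · intro x hx
    obtain ⟨hxc, hxe, hxO⟩ := hφsrc x hx
    constructor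
    · rintro ⟨q, rfl⟩
      obtain ⟨u, hu, rfl, hue, hq⟩ := hpt q hxO
      rw [hφapp, hq]
      exact horizontalIncl_mem u
    -- A horizontal point of the source of `e` has its first coordinates in `D`, since that source
    -- lies over `D`; there the ruled map is `g`, a parametrization of `N`.
    · intro hz
      set z := e.symm (c x) with hzdef
      have hzs : z ∈ e.source := e.map_target hxe
      have hzD : firstCoords hk z ∈ D := heD hzs
      refine ⟨d.symm (firstCoords hk z), c.injOn hzD.2.2 hxc ?_⟩
      have h1 : e z = c x := e.right_inv hxe
      rw [← h1, hecoe]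
      conv_rhs => rw [← horizontalIncl_firstCoords hk (z := z) hz]
      rw [ruledMap_horizontalIncl, hg]
  · intro q hq Z
    obtain ⟨hqc, hqe, hqO⟩ := hφsrc _ hq
    obtain ⟨u, hu, rfl, hue, hqu⟩ := hpt q hqO
    have hiff : (∀ i : Fin n, (i : ℕ) < k → derivAlong (fun x => φ x i) (ι (d.symm u)) Z = 0) ↔
        dchart φ (ι (d.symm u)) Z ∈ vertical k n := by
      rw [mem_vertical]
      exact forall₂_congr fun i _ => by rw [derivAlong_coord hφmem hq]
    rw [hiff]
    -- Differentiating `c = e ∘ φ` expresses the derivative of `φ` through that of the ruled map,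
    -- which is known explicitly over `N`.
    have hchain : fderiv ℝ (ruledMap hk g W) (horizontalIncl k n u)
        (dchart φ (ι (d.symm u)) Z) = dchart c (ι (d.symm u)) Z := by
      have e1 : (c : M → Rn n) =ᶠ[𝓝 (ι (d.symm u))] e ∘ φ := by
        filter_upwards [φ.open_source.mem_nhds hq] with x hx
        rw [Function.comp, hφapp, e.right_inv (hφsrc x hx).2.1]
      have e2 := mfderiv_comp (ι (d.symm u)) (I' := 𝓘(ℝ, Rn n))
        (I'' := 𝓘(ℝ, Rn n)) (g := e) (f := φ)
        (by
          rw [hφapp, hqu]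
          exact ((hes.contDiffAt (e.open_source.mem_nhds hue)).differentiableAt
            (by simp)).mdifferentiableAt)
        ((mdifferentiable_chart hφmem).mdifferentiableAt hq)
      rw [← e1.mfderiv_eq, mfderiv_eq_fderiv, hφapp, hqu, hecoe] at e2
      exact (DFunLike.congr_fun e2 Z).symm
    rw [hVν _ hu.2.1, Submodule.mem_span_range_iff_exists_fun]
    constructor
    · rintro ⟨b, rfl⟩
      have h1 := hvert u hu _ (verticalIncl_mem b)
      simp only [verticalIncl_lastIdx] at h1
      rw [← h1] at hchain
      -- The derivative is injective at every point of the source of `e`, so the normality condition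
      -- holds at all `q` in the chart, not only at `q₀`.
      rw [heinj _ hue hchain]
      exact verticalIncl_mem b
    · intro hη
      rw [hvert u hu _ hη] at hchain
      exact ⟨_, dchart_injective hc hqc hchain⟩

end Existence

end DiracGeom

end

/-! ### The equivalences. -/

open DiracGeom in
theorem proposition4p3 {n k : ℕ}
    {M : Type*} [TopologicalSpace M] [ChartedSpace (Rn n) M] [IsManifold (𝓡 n) ∞ M]
    {N : Type*} [TopologicalSpace N] [ChartedSpace (Rn k) N] [IsManifold (𝓡 k) ∞ N]
    (σ : TwoForm (𝓡 n) M) (hσ : IsPresymplectic σ)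
    (ι : N → M) (hι : Manifold.IsSmoothEmbedding (𝓡 k) (𝓡 n) ∞ ι) :
    (IsTotallyDirac k (graphOf σ) ι ↔
      ∃ ν : (q : N) → Submodule ℝ (TangentSpace (𝓡 n) (ι q)), IsNormalBundle k ι ν ∧
        IsIsotropic (𝓡 n).tangent (totalSet ι ν) (graphOf σ.completeLift)) ∧
    ∀ ν : (q : N) → Submodule ℝ (TangentSpace (𝓡 n) (ι q)), IsNormalBundle k ι ν →
      [IsTotallyDiracWith k (graphOf σ) ι ν,
        IsIsotropic (𝓡 n).tangent (totalSet ι ν) (graphOf σ.completeLift),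
        ∀ φ : OpenPartialHomeomorph M (Rn n), IsAdaptedChart k ι ν φ → LocalConditions k σ ι φ,
        ∀ q : N, ∃ φ : OpenPartialHomeomorph M (Rn n), ι q ∈ φ.source ∧
          IsAdaptedChart k ι ν φ ∧ LocalConditions k σ ι φ].TFAE := by
  have hιs : ContMDiff (𝓡 k) (𝓡 n) ∞ ι := hι.contMDiff
  have tfae : ∀ ν : (q : N) → Submodule ℝ (TangentSpace (𝓡 n) (ι q)), IsNormalBundle k ι ν →
      [IsTotallyDiracWith k (graphOf σ) ι ν,
        IsIsotropic (𝓡 n).tangent (totalSet ι ν) (graphOf σ.completeLift),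
        ∀ φ : OpenPartialHomeomorph M (Rn n), IsAdaptedChart k ι ν φ → LocalConditions k σ ι φ,
        ∀ q : N, ∃ φ : OpenPartialHomeomorph M (Rn n), ι q ∈ φ.source ∧
          IsAdaptedChart k ι ν φ ∧ LocalConditions k σ ι φ].TFAE := by
    intro ν hν
    have flat : (∀ q : N, ∃ φ : OpenPartialHomeomorph M (Rn n), ι q ∈ φ.source ∧
          IsAdaptedChart k ι ν φ ∧ LocalConditions k σ ι φ) → ∀ q : N,
        ∃ φ : OpenPartialHomeomorph M (Rn n), ι q ∈ φ.source ∧ IsAdaptedChart k ι ν φ ∧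
          FlatAt k (σ.inChart φ) (φ (ι q)) := by
      intro h q
      obtain ⟨φ, hq, hφ, hloc⟩ := h q
      exact ⟨φ, hq, hφ, (localConditions_iff hσ hφ.mem_atlas).1 hloc q hq⟩
    tfae_have 1 → 3 := fun h φ hφ => (localConditions_iff hσ hφ.mem_atlas).2 fun q hq =>
      hφ.flatAt_of_isTotallyDiracWith hσ hιs hν h hq
    tfae_have 2 → 3 := fun h φ hφ => (localConditions_iff hσ hφ.mem_atlas).2 fun q hq =>
      hφ.flatAt_of_completeLift hσ h hq
    tfae_have 3 → 4 := fun h q => by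
      obtain ⟨φ, hq, hφ⟩ := exists_adaptedChart hι hν q
      exact ⟨φ, hq, hφ, h φ hφ⟩
    tfae_have 4 → 1 := fun h => by
      refine ⟨fun q A α hA T hT hAT τ hτT hτν => ?_,
        fun q U hU hqU A B Z α β hA hB hZ hZν => ?_⟩
      · obtain ⟨φ, hq, hφ, hflat⟩ := flat h q
        exact hφ.graph_projection_mem hιs hν hq hflat hA hT hAT hτT hτν
      · obtain ⟨φ, hq, hφ, hflat⟩ := flat h q
        exact hφ.secondFundamentalValue_eq_zero hσ hιs hν hq hflat hU hqU hA hB hZ hZν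
    tfae_have 4 → 2 := fun h => by
      rw [isIsotropic_graphOf_iff]
      intro p hp A hA B hB
      obtain ⟨q, v, hv, rfl⟩ := id hp
      obtain ⟨φ, hq, hφ, hflat⟩ := flat h q
      exact hφ.completeLift_eq_zero hσ hq hp hflat hA hB
    tfae_finish
  refine ⟨?_, tfae⟩
  -- The criterion for being totally Dirac is the equivalence of the first two items, applied to
  -- each normal bundle.
  exact exists_congr fun ν => and_congr_right fun hν => (tfae ν hν).out 0 1
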